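/- Let $\Psi:[0,\infty)\to[0,\infty)$ be a finite Young function, i.e. a continuous, nondecreasing, convex function with $\Psi(0)=0$ and $\lim_{x\to\infty}\Psi(x)=\infty$. Let $(\Omega,\mathcal F,\mathbb P)$ be an atomless probability space, and let $H^\Psi$ be the Orlicz heart, i.e. the space of all (a.s. equivalence classes of) real random variables $X$ on $\Omega$ with $\mathbb E[\Psi(c|X|)]<\infty$ for all $c>0$. Let $\mathcal M(H^\Psi)$ be the set of the distributions $\mathbb P\circ X^{-1}$, $X\in H^\Psi$. A law-invariant convex risk measure on $H^\Psi$ is a map $\rho:H^\Psi\to\mathbb R$ such that for all $X,Y\in H^\Psi$: $\rho(X)\ge\rho(Y)$ if $X\le Y$ a.s.; $\rho(\lambda X+(1-\lambda)Y)\le\lambda\rho(X)+(1-\lambda)\rho(Y)$ for $\lambda\in[0,1]$; and $\rho(X)=\rho(Y)$ if $X$ and $Y$ have the same distribution. Its risk functional $\mathcal R_\rho:\mathcal M(H^\Psi)\to\mathbb R$ is defined by $\mathcal R_\rho(\mathbb P\circ X^{-1})=\rho(X)$. Let $\rho$ be any law-invariant convex risk measure on $H^\Psi$. Let $A_d:\mathbb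 R^d\to\mathbb R$ be a Borel measurable map of linear growth: there are constants $b,c>0$ with $|A_d(x)|\le b+c\sum_{i=1}^d|x_i|$ for all $x\in\mathbb R^d$. Let $\mu_1,\dots,\mu_d\in\mathcal M(H^\Psi)$, and let $$M:=M(\mu_1,\dots,\mu_d;A_d):=\{\boldsymbol\mu\circ A_d^{-1}:\ \boldsymbol\mu \text{ is a Borel probability measure on } \mathbb R^d \text{ with one-dimensional marginals } \mu_1,\dots,\mu_d\}.$$ Then $M\subseteq\mathcal M(H^\Psi)$, and the restriction of $\mathcal R_\rho$ to $M$ is continuous for the relative weak topology on $M$ (aggregation robustness). Moreover, all empirical probability measures $\widehat m_n(x)=\frac1n\sum_{i=1}^n\delta_{x_i}$ with $n\ge1$ and $x=(x_1,x_2,\dots)\in\mathbb R^{\mathbb N}$ belong to $\mathcal M(H^\Psi)$, the plug-in estimators $\widehat T_n:\mathbb R^{\mathbb N}\to\mathbb R$, $\widehat T_n(x):=\mathcal R_\rho(\widehat m_n(x))$, are measurable, and the sequence $(\widehat T_n)_{n\ge1}$ is robust on $M$: for every $\mu\in M$ and $\varepsilon>0$ there is a neighbourhood $U$ of $\mu$,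 open in the relative weak topology on $M$, such that $$\pi\big(\mu^{\otimes\mathbb N}\circ\widehat T_n^{-1},\ \nu^{\otimes\mathbb N}\circ\widehat T_n^{-1}\big)\le\varepsilon\qquad\text{for all }\nu\in U\text{ and all }n\ge1,$$ where $\pi$ denotes the Prohorov metric on the Borel probability measures on $\mathbb R$. -/

import Mathlib

open MeasureTheory Filter Topology
open scoped NNReal ENNReal

noncomputable section

namespace AggRobust

/-! ### Statistical model, plug-in estimators, qualitative robustness -/

section Robust

variable {E S : Type*} [MeasurableSpace E]

/-- The empirical probability measure `(1/n) ∑_{i<n} δ_{x i}` of the first `n ≥ 1` entries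
of the sequence `x` (entries are indexed from `0`). -/
def empiricalMeasure (n : ℕ+) (x : ℕ → E) : ProbabilityMeasure E :=
  ⟨((n : ℕ) : ℝ≥0∞)⁻¹ • ∑ i ∈ Finset.range n, Measure.dirac (x i), ⟨by
    simp only [Measure.smul_apply, Measure.finsetSum_apply, measure_univ, Finset.sum_const,
      Finset.card_range, smul_eq_mul, nsmul_eq_mul, mul_one]
    exact ENNReal.inv_mul_cancel (by simp) (ENNReal.natCast_ne_top _)⟩⟩

variable (E) in
/-- The set of all empirical probability measures on `E`. -/
def empiricalMeasures : Set (ProbabilityMeasure E) :=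
  {m | ∃ (n : ℕ+) (x : ℕ → E), m = empiricalMeasure n x}

/-- The plug-in estimator `x ↦ T (m̂ₙ(x))` of a statistical functional `T` whose domain `D`
contains all empirical probability measures. -/
def plugIn {D : Set (ProbabilityMeasure E)} (hD : empiricalMeasures E ⊆ D) (T : D → S)
    (n : ℕ+) (x : ℕ → E) : S :=
  T ⟨empiricalMeasure n x, hD ⟨n, x, rfl⟩⟩

/-- The law, under the infinite product measure `μ^{⊗ℕ}`, of an estimator `t : E^ℕ → S`. -/
def estimatorLaw [MeasurableSpace S] (μ : ProbabilityMeasure E) (t : (ℕ → E) → S) : Measure S :=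
  (Measure.infinitePi fun _ : ℕ => (μ : Measure E)).map t

variable [TopologicalSpace E] [OpensMeasurableSpace E]
  [MeasurableSpace S] [PseudoMetricSpace S]

/-- `M`-robustness at `μ` of a sequence of estimators `t n`, `n ≥ 1`: the neighbourhood `U` is
open in the relative weak topology of `M`, and does not depend on `n`. -/
def IsRobustAt (t : ℕ+ → (ℕ → E) → S) (M : Set (ProbabilityMeasure E)) (μ : M) : Prop :=
  ∀ ε : ℝ, 0 < ε → ∃ U : Set M, IsOpen U ∧ μ ∈ U ∧ ∀ ν ∈ U, ∀ n : ℕ+,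
    levyProkhorovDist (estimatorLaw (μ : ProbabilityMeasure E) (t n))
      (estimatorLaw (ν : ProbabilityMeasure E) (t n)) ≤ ε

/-- Robustness of a sequence of estimators on `M`. -/
def IsRobustOn (t : ℕ+ → (ℕ → E) → S) (M : Set (ProbabilityMeasure E)) : Prop :=
  ∀ μ : M, IsRobustAt t M μ

end Robust

/-! ### Orlicz hearts and law-invariant convex risk measures -/

/-- A finite Young function `Ψ : [0,∞) → [0,∞)`. -/
structure YoungFunction where
  toFun : ℝ≥0 → ℝ≥0
  continuous : Continuous toFun
  monotone : Monotone toFun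
  convex : ConvexOn ℝ≥0 Set.univ toFun
  map_zero : toFun 0 = 0
  tendsto_atTop : Tendsto toFun atTop atTop

section Orlicz

variable {Ω : Type*} [MeasurableSpace Ω]

/-- Atomless measures: every measurable set of positive measure has a measurable subset of
strictly smaller positive measure. (This is stronger than all singletons being null.) -/
def IsAtomless (P : Measure Ω) : Prop :=
  ∀ A : Set Ω, MeasurableSet A → 0 < P A →
    ∃ B : Set Ω, MeasurableSet B ∧ B ⊆ A ∧ 0 < P B ∧ P B < P A

/-- The Orlicz heart: the space of all (classes of a.s. equal) random variables `X` with
`E[Ψ(c|X|)] < ∞` for every `c > 0`. -/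
def orliczHeart (Ψ : YoungFunction) (P : Measure Ω) : Submodule ℝ (Ω →ₘ[P] ℝ) where
  carrier := {X | ∀ c : ℝ≥0, 0 < c → ∫⁻ ω, (Ψ.toFun (c * ‖X ω‖₊) : ℝ≥0∞) ∂P < ∞}
  zero_mem' := by
    intro c _
    have h : (fun ω => (Ψ.toFun (c * ‖(0 : Ω →ₘ[P] ℝ) ω‖₊) : ℝ≥0∞)) =ᵐ[P] fun _ => 0 := by
      filter_upwards [AEEqFun.coeFn_zero (α := Ω) (β := ℝ) (μ := P)] with ω hω
      simp [hω, Ψ.map_zero]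
    rw [lintegral_congr_ae h]
    simp
  add_mem' := by
    intro X Y hX hY c hc
    have h2 : (0 : ℝ≥0) < 2 * c := by positivity
    have key : ∀ᵐ ω ∂P, (Ψ.toFun (c * ‖(X + Y) ω‖₊) : ℝ≥0∞) ≤
        (Ψ.toFun (2 * c * ‖X ω‖₊) : ℝ≥0∞) + (Ψ.toFun (2 * c * ‖Y ω‖₊) : ℝ≥0∞) := by
      filter_upwards [AEEqFun.coeFn_add X Y] with ω hω
      rw [hω, Pi.add_apply]
      norm_cast
      have hle : c * ‖X ω + Y ω‖₊ ≤
          (2⁻¹ : ℝ≥0) • (2 * c * ‖X ω‖₊) + (2⁻¹ : ℝ≥0) • (2 * c * ‖Y ω‖₊) := by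
        have e : ∀ z : ℝ≥0, (2⁻¹ : ℝ≥0) • (2 * c * z) = c * z := by
          intro z
          rw [smul_eq_mul, mul_assoc, inv_mul_cancel_left₀ two_ne_zero]
        rw [e, e, ← mul_add]
        gcongr
        exact nnnorm_add_le _ _
      refine (Ψ.monotone hle).trans ?_
      refine (Ψ.convex.2 (Set.mem_univ _) (Set.mem_univ _) (by simp) (by simp)
        (by rw [← two_mul, mul_inv_cancel₀ two_ne_zero])).trans ?_
      have f : ∀ z : ℝ≥0, (2⁻¹ : ℝ≥0) • z ≤ z := by
        intro z
        rw [smul_eq_mul]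
        exact mul_le_of_le_one_left (by simp) (inv_le_one_of_one_le₀ one_le_two)
      exact add_le_add (f _) (f _)
    refine (lintegral_mono_ae key).trans_lt ?_
    rw [lintegral_add_left']
    · exact ENNReal.add_lt_top.2 ⟨hX _ h2, hY _ h2⟩
    · have hm : Measurable fun z : ℝ => (Ψ.toFun (2 * c * ‖z‖₊) : ℝ≥0∞) :=
        (ENNReal.continuous_coe.comp
          (Ψ.continuous.comp (continuous_const.mul continuous_nnnorm))).measurable
      exact hm.comp_aemeasurable X.aestronglyMeasurable.aemeasurable
  smul_mem' := by
    intro a X hX c hc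
    have h : (fun ω => (Ψ.toFun (c * ‖(a • X) ω‖₊) : ℝ≥0∞)) =ᵐ[P]
        fun ω => (Ψ.toFun (c * ‖a‖₊ * ‖X ω‖₊) : ℝ≥0∞) := by
      filter_upwards [AEEqFun.coeFn_smul a X] with ω hω
      rw [hω, Pi.smul_apply, nnnorm_smul, mul_assoc]
    rw [lintegral_congr_ae h]
    rcases eq_or_ne a 0 with rfl | ha
    · simp [Ψ.map_zero]
    · exact hX _ (mul_pos hc (nnnorm_pos.2 ha))

/-- A law-invariant convex risk measure on the Orlicz heart. Cash additivity is not required. -/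
structure RiskMeasure (Ψ : YoungFunction) (P : Measure Ω) where
  toFun : orliczHeart Ψ P → ℝ
  antitone : ∀ X Y : orliczHeart Ψ P,
    (X : Ω →ₘ[P] ℝ) ≤ᵐ[P] (Y : Ω →ₘ[P] ℝ) → toFun Y ≤ toFun X
  convex : ∀ (X Y : orliczHeart Ψ P) (l : ℝ), 0 ≤ l → l ≤ 1 →
    toFun (l • X + (1 - l) • Y) ≤ l * toFun X + (1 - l) * toFun Y
  law_invariant : ∀ X Y : orliczHeart Ψ P,
    P.map (X : Ω →ₘ[P] ℝ) = P.map (Y : Ω →ₘ[P] ℝ) → toFun X = toFun Y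

/-- The set of the distributions of all random variables from the Orlicz heart. -/
def laws (Ψ : YoungFunction) (P : Measure Ω) : Set (ProbabilityMeasure ℝ) :=
  {μ | ∃ X : orliczHeart Ψ P, P.map (X : Ω →ₘ[P] ℝ) = (μ : Measure ℝ)}

/-- The risk functional of `ρ`, which maps the law of `X` to `ρ X`; by law-invariance the
choice of `X` is irrelevant, see `riskFunctional_eq`. -/
def riskFunctional {Ψ : YoungFunction} {P : Measure Ω} (ρ : RiskMeasure Ψ P)
    (μ : laws Ψ P) : ℝ :=
  ρ.toFun μ.2.choose

theorem riskFunctional_eq {Ψ : YoungFunction} {P : Measure Ω} (ρ : RiskMeasure Ψ P)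
    (μ : laws Ψ P) (X : orliczHeart Ψ P)
    (hX : P.map (X : Ω →ₘ[P] ℝ) = ((μ : ProbabilityMeasure ℝ) : Measure ℝ)) :
    riskFunctional ρ μ = ρ.toFun X :=
  ρ.law_invariant _ _ (μ.2.choose_spec.trans hX.symm)

end Orlicz

/-! ### Fréchet classes and their images -/

/-- The Fréchet class: all Borel probability measures on `ℝ^d` with marginals `μ i`. -/
def frechetClass {d : ℕ} (μ : Fin d → ProbabilityMeasure ℝ) :
    Set (ProbabilityMeasure (Fin d → ℝ)) :=
  {m | ∀ i, (m : Measure (Fin d → ℝ)).map (fun x => x i) = (μ i : Measure ℝ)}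

/-- The set of the image measures under `A` of the members of the Fréchet class. -/
def frechetImage {d : ℕ} (μ : Fin d → ProbabilityMeasure ℝ) (A : (Fin d → ℝ) → ℝ) :
    Set (ProbabilityMeasure ℝ) :=
  {ν | ∃ m ∈ frechetClass μ, (ν : Measure ℝ) = (m : Measure (Fin d → ℝ)).map A}

end AggRobust

end

/-! The argument turns weak convergence into modular convergence of random variables, and then uses
that a finite monotone convex functional on an Orlicz heart is automatically continuous for it.

Tails: by linear growth, `Ψ (c |A x|)` exceeds a high level `R` by no more than the sum of the
excesses of `Ψ (C |x i|)` for one fixed `C`. Integrating against a coupling leaves only the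
marginals, so the tails of all moments are uniformly small over the whole Fréchet image
(`exists_lintegral_tsub_le_frechetImage`). This is the only place where fixed marginals and growth
are used.

Continuity: an atomless space carries a uniform variable `U` (`IsAtomless.exists_uniform`), hence
the variables `quantile ν (U ω)`. Weak convergence makes quantile functions converge almost
everywhere, and uniform tails upgrade this to `∫ Ψ (c |q_k - q|) → 0` for every `c`
(`UniformTails.tendsto_lintegral_quantile`). A subsequence then satisfies `j |X_j - Y| ≤ W` with a
single `W` in the heart (`exists_orliczHeart_ge_mul`). Monotonicity squeezes `ρ X_j` between the
values of `ρ` at `Y ± W / j`, and a finite convex function on a line is continuous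
(`RiskMeasure.tendsto_of_modular`).

Robustness: samples of `ν` and `μ` are coupled by applying both quantile functions to the same
independent uniforms. The expected average of `Ψ (c |x_i - y_i|)` over the first `n` observations is
the above integral, whatever `n` is (`lintegral_meanGap_sample`); hence the uniformity in `n`. Along
any sequence `ν_k → μ` with arbitrary sample sizes `n_k`, a subsequence has almost surely vanishing
gaps. The sizes may be taken constant or divergent; in the latter case the law of large numbers
controls the empirical measures of `μ`. Either way the two estimates approach each other almost
surely, hence in probability, and the coupling bounds the Prohorov distance. -/

noncomputable section

namespace AggRobust

/-! ### A uniformly distributed random variable on an atomless space -/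

section Uniform

variable {Ω : Type*} [MeasurableSpace Ω] {P : Measure Ω}

/-- A family of measurable sets that is totally ordered according to its measures has a
measurable least upper bound, whose measure obeys every common bound of their measures. -/
theorem exists_measurable_lub_of_chain (S : Set (Set Ω)) (hm : ∀ B ∈ S, MeasurableSet B)
    (hS : ∀ B ∈ S, ∀ B' ∈ S, P B ≤ P B' → B ⊆ B') (t : ℝ≥0∞) (ht : ∀ B ∈ S, P B ≤ t) :
    ∃ D, MeasurableSet D ∧ (∀ B ∈ S, B ⊆ D) ∧ P D ≤ t ∧
      ∀ E : Set Ω, (∀ B ∈ S, B ⊆ E) → D ⊆ E := by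
  rcases S.eq_empty_or_nonempty with rfl | hne
  · exact ⟨∅, MeasurableSet.empty, by simp, by simp, by simp⟩
  -- If the supremum of the measures is not attained, every member lies below some term of a
  -- sequence whose measures tend to the supremum, so a countable union suffices.
  by_cases hmax : ∃ D ∈ S, ∀ B ∈ S, P B ≤ P D
  · obtain ⟨D, hD, hDm⟩ := hmax
    exact ⟨D, hm D hD, fun B hB => hS B hB D hD (hDm B hB), ht D hD, fun E hE => hE D hD⟩
  push Not at hmax
  obtain ⟨u, -, hu, huS⟩ := exists_seq_tendsto_sSup (hne.image P) (OrderTop.bddAbove _)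
  choose D hDS hDu using huS
  refine ⟨⋃ n, D n, MeasurableSet.iUnion fun n => hm _ (hDS n), fun B hB => ?_, ?_,
    fun E hE => Set.iUnion_subset fun n => hE _ (hDS n)⟩
  · obtain ⟨B', hB', hlt⟩ := hmax B hB
    have : P B < sSup (P '' S) := hlt.trans_le (le_sSup ⟨B', hB', rfl⟩)
    obtain ⟨n, hn⟩ := (hu.eventually_const_lt this).exists
    refine (hS B hB _ (hDS n) ?_).trans (Set.subset_iUnion D n)
    rw [hDu]
    exact hn.le
  · have hdir : Directed (· ⊆ ·) D := by
      intro i j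
      rcases le_total (P (D i)) (P (D j)) with h | h
      · exact ⟨j, hS _ (hDS i) _ (hDS j) h, subset_rfl⟩
      · exact ⟨i, subset_rfl, hS _ (hDS j) _ (hDS i) h⟩
    rw [hdir.measure_iUnion]
    exact iSup_le fun n => ht _ (hDS n)

/-- An atomless probability space carries a totally ordered family of measurable sets whose
measures exhaust the unit interval. -/
theorem IsAtomless.exists_chain [IsProbabilityMeasure P] (hP : IsAtomless P) :
    ∃ C : Set (Set Ω), (∀ B ∈ C, MeasurableSet B) ∧
      (∀ B ∈ C, ∀ B' ∈ C, P B ≤ P B' → B ⊆ B') ∧ ∀ t : ℝ≥0∞, t ≤ 1 → ∃ B ∈ C, P B = t := by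
  -- Requiring a strict increase of measure, besides inclusion, forces distinct members of a chain
  -- to have distinct measures.
  let r : {B : Set Ω // MeasurableSet B} → {B : Set Ω // MeasurableSet B} → Prop :=
    fun A B => (A : Set Ω) ⊆ B ∧ P A < P B
  have hspec : IsMaxChain r (maxChain r) := maxChain_spec
  set C : Set (Set Ω) := Subtype.val '' maxChain r with hC
  have hCm : ∀ B ∈ C, MeasurableSet B := by rintro _ ⟨B, _, rfl⟩; exact B.2
  have hCs : ∀ B ∈ C, ∀ B' ∈ C, P B ≤ P B' → B ⊆ B' := by
    rintro _ ⟨B, hB, rfl⟩ _ ⟨B', hB', rfl⟩ hle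
    by_cases h : B = B'
    · rw [h]
    rcases hspec.1 hB hB' h with h1 | h1
    · exact h1.1
    · exact absurd h1.2 hle.not_gt
  -- Maximality: a measurable set strictly comparable with all members is itself a member.
  have hins : ∀ E : Set Ω, MeasurableSet E →
      (∀ B ∈ C, (B ⊆ E ∧ P B < P E) ∨ (E ⊆ B ∧ P E < P B)) → E ∈ C := by
    intro E hE hcomp
    have hch : IsChain r (insert ⟨E, hE⟩ (maxChain r)) :=
      hspec.1.insert fun b hb _ => (hcomp b ⟨b, hb, rfl⟩).symm
    have heq := hspec.2 hch (Set.subset_insert _ _)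
    exact ⟨⟨E, hE⟩, heq ▸ Set.mem_insert _ _, rfl⟩
  refine ⟨C, hCm, hCs, fun t ht1 => ?_⟩
  by_contra hno
  push Not at hno
  obtain ⟨L, hLm, hLub, hLt, hLmin⟩ := exists_measurable_lub_of_chain (P := P)
    {B ∈ C | P B < t} (fun B hB => hCm B hB.1) (fun B hB B' hB' => hCs B hB.1 B' hB'.1) t
    (fun B hB => hB.2.le)
  -- Dually, `Vᶜ` is the greatest lower bound of the members of measure above `t`, so `L` and `Vᶜ`
  -- enclose the gap of the chain at `t`.
  obtain ⟨V, hVm, hVub, hVt, hVmin⟩ := exists_measurable_lub_of_chain (P := P)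
    (compl '' {B ∈ C | t < P B})
    (by rintro _ ⟨B, hB, rfl⟩; exact (hCm B hB.1).compl)
    (by
      rintro _ ⟨B, hB, rfl⟩ _ ⟨B', hB', rfl⟩ hle
      refine Set.compl_subset_compl.2 (hCs B' hB'.1 B hB.1 ?_)
      rw [prob_compl_eq_one_sub (hCm B hB.1), prob_compl_eq_one_sub (hCm B' hB'.1)] at hle
      exact (ENNReal.sub_le_sub_iff_left prob_le_one ENNReal.one_ne_top).1 hle)
    (1 - t)
    (by
      rintro _ ⟨B, hB, rfl⟩
      rw [prob_compl_eq_one_sub (hCm B hB.1)]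
      exact tsub_le_tsub_left hB.2.le 1)
  have hVt' : t ≤ P Vᶜ := by
    rw [prob_compl_eq_one_sub hVm]
    calc t = 1 - (1 - t) := (ENNReal.sub_sub_cancel ENNReal.one_ne_top ht1).symm
      _ ≤ 1 - P V := tsub_le_tsub_left hVt 1
  have hLV : L ⊆ Vᶜ := by
    refine hLmin _ fun B hB => Set.subset_compl_comm.1 (hVmin _ ?_)
    rintro _ ⟨B', hB', rfl⟩
    exact Set.compl_subset_compl.2 (hCs B hB.1 B' hB'.1 (hB.2.trans hB'.2).le)
  have hVlb : ∀ B ∈ C, t < P B → Vᶜ ⊆ B := fun B hB h =>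
    Set.compl_subset_comm.1 (hVub _ ⟨B, ⟨hB, h⟩, rfl⟩)
  have hmain : ∀ E : Set Ω, MeasurableSet E → L ⊆ E → E ⊆ Vᶜ → (P L < P E ∨ P E = t) →
      (P E < P Vᶜ ∨ P E = t) → E ∈ C := by
    intro E hE h1 h2 h3 h4
    refine hins E hE fun B hB => ?_
    rcases lt_trichotomy (P B) t with h | h | h
    · have hBL : B ⊆ L := hLub B ⟨hB, h⟩
      refine Or.inl ⟨hBL.trans h1, ?_⟩
      rcases h3 with h3 | h3
      · exact (measure_mono hBL).trans_lt h3
      · rwa [h3]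
    · exact absurd h (hno B hB)
    · have hBL := hVlb B hB h
      refine Or.inr ⟨h2.trans hBL, ?_⟩
      rcases h4 with h4 | h4
      · exact h4.trans_le (measure_mono hBL)
      · rwa [h4]
  have hdiff : P (Vᶜ \ L) = P Vᶜ - P L :=
    measure_sdiff hLV hLm.nullMeasurableSet (measure_ne_top _ _)
  -- A null gap makes `L` a set of measure `t` that can be inserted. Otherwise atomlessness yields
  -- `L ∪ D` strictly inside the gap; it belongs to the chain, against the choice of `L` and `Vᶜ`.
  rcases (zero_le : 0 ≤ P (Vᶜ \ L)).eq_or_lt with h0 | hpos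
  · have : P L = t := le_antisymm hLt (hVt'.trans (tsub_eq_zero_iff_le.1 (hdiff ▸ h0.symm)))
    exact hno L (hmain L hLm subset_rfl hLV (Or.inr this) (Or.inr this)) this
  · obtain ⟨D, hDm, hDs, hD0, hD1⟩ := hP _ (hVm.compl.diff hLm) hpos
    have hdisj : Disjoint L D :=
      Set.disjoint_left.2 fun x hx hxD => (hDs hxD).2 hx
    have hE : P (L ∪ D) = P L + P D := measure_union hdisj hDm
    have hlt1 : P L < P (L ∪ D) := by
      rw [hE]; exact ENNReal.lt_add_right (measure_ne_top _ _) hD0.ne'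
    have hlt2 : P (L ∪ D) < P Vᶜ := by
      rw [hE, ← add_tsub_cancel_of_le (measure_mono hLV : P L ≤ P Vᶜ), ← hdiff]
      exact ENNReal.add_lt_add_left (measure_ne_top _ _) hD1
    have hmem := hmain (L ∪ D) (hLm.union hDm) Set.subset_union_left
      (Set.union_subset hLV fun x hx => (hDs hx).1) (Or.inl hlt1) (Or.inl hlt2)
    rcases lt_trichotomy (P (L ∪ D)) t with h | h | h
    · exact (measure_mono (hLub _ ⟨hmem, h⟩)).not_gt hlt1
    · exact hno _ hmem h
    · exact (measure_mono (hVlb _ hmem h)).not_gt hlt2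

/-- The uniform distribution on the unit interval. -/
def unif : Measure ℝ := volume.restrict (Set.Ioo 0 1)

instance : IsProbabilityMeasure unif := ⟨by simp [unif]⟩

theorem unif_Ici (s : ℝ) (h0 : 0 < s) : unif (Set.Ici s) = ENNReal.ofReal (1 - s) := by
  have : Set.Ici s ∩ Set.Ioo 0 1 = Set.Ico s 1 := by
    ext x
    simp only [Set.mem_inter_iff, Set.mem_Ici, Set.mem_Ioo, Set.mem_Ico]
    constructor
    · rintro ⟨a, -, b⟩; exact ⟨a, b⟩
    · rintro ⟨a, b⟩; exact ⟨a, h0.trans_le a, b⟩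
  rw [unif, Measure.restrict_apply measurableSet_Ici, this, Real.volume_Ico]

/-- An atomless probability space carries a uniformly distributed random variable. -/
theorem IsAtomless.exists_uniform [IsProbabilityMeasure P] (hP : IsAtomless P) :
    ∃ U : Ω → ℝ, Measurable U ∧ P.map U = unif := by
  obtain ⟨C, hCm, hCs, hCt⟩ := hP.exists_chain
  have hex : ∀ q : ℚ, ∃ B ∈ C, P B = min (ENNReal.ofReal q) 1 := fun q => hCt _ (min_le_right _ _)
  choose B hBC hBP using hex
  -- The chain acts as the family of level sets of `U`. The element `1` keeps the infimum meaningful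
  -- where no `B q` contains `ω`, and gives `U ≤ 1`.
  let S : Ω → Set ℝ := fun ω => insert 1 {x | ∃ q : ℚ, 0 < q ∧ ω ∈ B q ∧ x = q}
  have hSne : ∀ ω, (S ω).Nonempty := fun ω => ⟨1, Set.mem_insert _ _⟩
  have hS0 : ∀ ω, ∀ x ∈ S ω, 0 ≤ x := by
    rintro ω x (rfl | ⟨q, hq, -, rfl⟩)
    · exact zero_le_one
    · exact_mod_cast hq.le
  have hSb : ∀ ω, BddBelow (S ω) := fun ω => ⟨0, fun x hx => hS0 ω x hx⟩
  let U : Ω → ℝ := fun ω => sInf (S ω)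
  have hU0 : ∀ ω, 0 ≤ U ω := fun ω => le_csInf (hSne ω) (hS0 ω)
  have hU1 : ∀ ω, U ω ≤ 1 := fun ω => csInf_le (hSb ω) (Set.mem_insert _ _)
  have hlt : ∀ s : ℝ, s ≤ 1 → {ω | U ω < s} = ⋃ q : {q : ℚ // 0 < q ∧ (q : ℝ) < s}, B q := by
    intro s hs
    ext ω
    simp only [Set.mem_ofPred_eq, Set.mem_iUnion, U, csInf_lt_iff (hSb ω) (hSne ω)]
    constructor
    · rintro ⟨x, rfl | ⟨q, hq, hqB, rfl⟩, hx⟩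
      · exact absurd hx hs.not_gt
      · exact ⟨⟨q, hq, hx⟩, hqB⟩
    · rintro ⟨⟨q, hq, hx⟩, hqB⟩
      exact ⟨q, Or.inr ⟨q, hq, hqB, rfl⟩, hx⟩
  have hUm : Measurable U := by
    refine measurable_of_Iio fun s => ?_
    rcases le_or_gt s 1 with hs | hs
    · change MeasurableSet {ω | U ω < s}
      rw [hlt s hs]
      exact MeasurableSet.iUnion fun q => hCm _ (hBC _)
    · have : U ⁻¹' Set.Iio s = Set.univ := by
        ext ω; simpa using (hU1 ω).trans_lt hs
      rw [this]; exact MeasurableSet.univ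
  have hPlt : ∀ s : ℝ, s ≤ 1 → P {ω | U ω < s} = ENNReal.ofReal s := by
    intro s hs
    rw [hlt s hs]
    have hmono : ∀ p q : ℚ, p ≤ q → B p ⊆ B q := fun p q h => by
      refine hCs _ (hBC p) _ (hBC q) ?_
      rw [hBP, hBP]
      exact min_le_min_right _ (ENNReal.ofReal_le_ofReal (by exact_mod_cast h))
    have hdir : Directed (· ⊆ ·) fun q : {q : ℚ // 0 < q ∧ (q : ℝ) < s} => B q := by
      intro i j
      rcases le_total i.1 j.1 with h | h
      · exact ⟨j, hmono _ _ h, subset_rfl⟩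
      · exact ⟨i, subset_rfl, hmono _ _ h⟩
    rw [hdir.measure_iUnion]
    refine le_antisymm (iSup_le fun q => ?_) (le_of_forall_lt fun c hc => ?_)
    · rw [hBP]
      exact (min_le_left _ _).trans (ENNReal.ofReal_le_ofReal q.2.2.le)
    · have hcs : c.toReal < s := (ENNReal.lt_ofReal_iff_toReal_lt (ne_top_of_lt hc)).1 hc
      obtain ⟨q, hq1, hq2⟩ := exists_rat_btwn hcs
      have hq0 : (0 : ℝ) < q := ENNReal.toReal_nonneg.trans_lt hq1
      refine lt_of_lt_of_le ?_ (le_iSup (fun q : {q : ℚ // 0 < q ∧ (q : ℝ) < s} => P (B q))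
        ⟨q, by exact_mod_cast hq0, hq2⟩)
      change c < P (B q)
      have h1 : ENNReal.ofReal q ≤ 1 := ENNReal.ofReal_le_one.2 (hq2.le.trans hs)
      rw [hBP, min_eq_left h1]
      exact (ENNReal.lt_ofReal_iff_toReal_lt (ne_top_of_lt hc)).2 hq1
  refine ⟨U, hUm, ?_⟩
  have : IsProbabilityMeasure (P.map U) := Measure.isProbabilityMeasure_map hUm.aemeasurable
  refine Measure.ext_of_Ici _ _ fun s => ?_
  rw [Measure.map_apply hUm measurableSet_Ici]
  rcases le_or_gt s 0 with h0 | h0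
  · have h1 : U ⁻¹' Set.Ici s = Set.univ := by
      ext ω; simpa using h0.trans (hU0 ω)
    have h2 : Set.Ici s ∩ Set.Ioo (0 : ℝ) 1 = Set.Ioo 0 1 :=
      Set.inter_eq_right.2 fun x hx => h0.trans hx.1.le
    rw [h1, measure_univ, unif, Measure.restrict_apply measurableSet_Ici, h2]
    simp
  rw [unif_Ici s h0]
  have hcompl : U ⁻¹' Set.Ici s = {ω | U ω < s}ᶜ := by ext ω; simp
  rcases le_or_gt s 1 with h1 | h1
  · rw [hcompl, prob_compl_eq_one_sub (measurableSet_lt hUm measurable_const), hPlt s h1,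
      ENNReal.ofReal_sub _ h0.le, ENNReal.ofReal_one]
  · have : U ⁻¹' Set.Ici s = ∅ := by
      ext ω; simpa using (hU1 ω).trans_lt h1
    rw [this, measure_empty, ENNReal.ofReal_of_nonpos (by linarith)]

end Uniform

/-! ### Quantile functions -/

section Quantile

open ProbabilityTheory

/-- The lower quantile function of `ν`, extended by `0` outside the open unit interval. -/
def quantile (ν : Measure ℝ) (u : ℝ) : ℝ :=
  open Classical in if u ∈ Set.Ioo (0 : ℝ) 1 then sInf {x | u ≤ cdf ν x} else 0

/-- The superlevel set of the distribution function is a closed half-line, by monotonicity and right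
continuity, so its infimum is attained. This Galois connection is all that is used about quantiles
later on. -/
theorem quantile_le_iff (ν : Measure ℝ) {u : ℝ} (hu : u ∈ Set.Ioo (0 : ℝ) 1) (x : ℝ) :
    quantile ν u ≤ x ↔ u ≤ cdf ν x := by
  have hne : {x | u ≤ cdf ν x}.Nonempty :=
    ((tendsto_cdf_atTop ν).eventually_const_le hu.2).exists
  have hbd : BddBelow {x | u ≤ cdf ν x} := by
    obtain ⟨y, hy⟩ := ((tendsto_cdf_atBot ν).eventually_lt_const hu.1).exists
    refine ⟨y, fun x hx => ?_⟩
    by_contra hxy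
    exact (hx.trans (monotone_cdf ν (not_le.1 hxy).le)).not_gt hy
  rw [quantile, if_pos hu]
  constructor
  · intro h
    have hgt : ∀ y, x < y → u ≤ cdf ν y := fun y hy => by
      obtain ⟨z, hz, hzy⟩ := (csInf_lt_iff hbd hne).1 (h.trans_lt hy)
      exact (show u ≤ cdf ν z from hz).trans (monotone_cdf ν hzy.le)
    have ht : Tendsto (cdf ν) (𝓝[>] x) (𝓝 (cdf ν x)) :=
      ((cdf ν).right_continuous x).tendsto.mono_left (nhdsWithin_mono _ Set.Ioi_subset_Ici_self)
    exact ge_of_tendsto ht (eventually_mem_nhdsWithin.mono fun y hy => hgt y hy)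
  · exact fun h => csInf_le hbd h

theorem measurable_quantile (ν : Measure ℝ) : Measurable (quantile ν) := by
  refine measurable_of_Iic fun x => ?_
  have : quantile ν ⁻¹' Set.Iic x = (Set.Ioo 0 1 ∩ Set.Iic (cdf ν x)) ∪
      ((Set.Ioo 0 1)ᶜ ∩ {_u | 0 ≤ x}) := by
    ext u
    by_cases hu : u ∈ Set.Ioo (0 : ℝ) 1
    · simp only [Set.mem_preimage, Set.mem_Iic, Set.mem_union, Set.mem_inter_iff, hu,
        Set.mem_compl_iff, not_true, false_and, or_false, true_and]
      exact quantile_le_iff ν hu x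
    · simp only [Set.mem_preimage, Set.mem_Iic, Set.mem_union, Set.mem_inter_iff, hu,
        Set.mem_compl_iff, not_false_iff, false_and, false_or, true_and, Set.mem_ofPred_eq]
      rw [quantile, if_neg hu]
  rw [this]
  exact (measurableSet_Ioo.inter measurableSet_Iic).union
    (measurableSet_Ioo.compl.inter (MeasurableSet.const _))

theorem map_quantile (ν : Measure ℝ) [IsProbabilityMeasure ν] : unif.map (quantile ν) = ν := by
  have : IsProbabilityMeasure (unif.map (quantile ν)) :=
    Measure.isProbabilityMeasure_map (measurable_quantile ν).aemeasurable
  refine Measure.ext_of_Iic _ _ fun x => ?_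
  rw [Measure.map_apply (measurable_quantile ν) measurableSet_Iic, ← ofReal_cdf, unif,
    Measure.restrict_apply (measurable_quantile ν measurableSet_Iic)]
  have heq : quantile ν ⁻¹' Set.Iic x ∩ Set.Ioo 0 1 = Set.Iic (cdf ν x) ∩ Set.Ioo 0 1 := by
    ext u
    simp only [Set.mem_inter_iff, Set.mem_preimage, Set.mem_Iic]
    exact and_congr_left fun hu => quantile_le_iff ν hu x
  rw [heq]
  refine le_antisymm ?_ ?_
  · refine (measure_mono (t := Set.Ioc 0 (cdf ν x)) fun u hu => ⟨hu.2.1, hu.1⟩).trans ?_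
    rw [Real.volume_Ioc, sub_zero]
  · refine le_trans ?_ (measure_mono (s := Set.Ioo 0 (cdf ν x)) fun u hu =>
      ⟨hu.2.le, hu.1, hu.2.trans_le (cdf_le_one ν x)⟩)
    rw [Real.volume_Ioo, sub_zero]

/-- The continuous piecewise linear function that is `1` on `(-∞, p]` and `0` on `[q, ∞)`. -/
def ramp (p q y : ℝ) : ℝ := max 0 (min 1 ((q - y) / (q - p)))

theorem ramp_nonneg (p q y : ℝ) : 0 ≤ ramp p q y := le_max_left _ _

theorem ramp_le_one (p q y : ℝ) : ramp p q y ≤ 1 := max_le zero_le_one (min_le_left _ _)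

theorem continuous_ramp (p q : ℝ) : Continuous (ramp p q) := by
  unfold ramp; fun_prop

theorem indicator_Iic_le_ramp {p q : ℝ} (h : p < q) (y : ℝ) :
    (Set.Iic p).indicator (fun _ => (1 : ℝ)) y ≤ ramp p q y := by
  by_cases hy : y ≤ p
  · rw [Set.indicator_of_mem (show y ∈ Set.Iic p from hy)]
    refine le_max_of_le_right (le_min le_rfl ?_)
    rw [le_div_iff₀ (sub_pos.2 h)]
    linarith
  · rw [Set.indicator_of_notMem (show y ∉ Set.Iic p from hy)]
    exact ramp_nonneg _ _ _

theorem ramp_le_indicator_Iic {p q : ℝ} (h : p < q) (y : ℝ) :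
    ramp p q y ≤ (Set.Iic q).indicator (fun _ => (1 : ℝ)) y := by
  by_cases hy : y ≤ q
  · rw [Set.indicator_of_mem (show y ∈ Set.Iic q from hy)]
    exact ramp_le_one _ _ _
  · rw [Set.indicator_of_notMem (show y ∉ Set.Iic q from hy)]
    refine max_le le_rfl ((min_le_right _ _).trans ?_)
    exact div_nonpos_of_nonpos_of_nonneg (by linarith) (by linarith)

/-- The truncated distance on the right is what a Young function can control, see
`YoungFunction.exists_min_le_add_scaled`. -/
theorem abs_ramp_sub_le {p q : ℝ} (h : p < q) (x y : ℝ) :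
    |ramp p q x - ramp p q y| ≤ (1 + (q - p)⁻¹) * min 1 |x - y| := by
  have hpos : 0 < (q - p)⁻¹ := inv_pos.2 (sub_pos.2 h)
  have h1 : |ramp p q x - ramp p q y| ≤ 1 := by
    rw [abs_le]
    constructor <;>
      linarith [ramp_nonneg p q x, ramp_le_one p q x, ramp_nonneg p q y, ramp_le_one p q y]
  have h2 : |ramp p q x - ramp p q y| ≤ (q - p)⁻¹ * |x - y| := by
    refine (abs_max_sub_max_le_abs _ _ 0 |>.trans' ?_).trans
      (b := |min 1 ((q - x) / (q - p)) - min 1 ((q - y) / (q - p))|) ?_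
    · rw [ramp, ramp, max_comm 0, max_comm 0]
    · refine (abs_min_sub_min_le_max _ _ _ _).trans ?_
      rw [sub_self, abs_zero, max_eq_right (abs_nonneg _), ← sub_div, div_eq_inv_mul, abs_mul,
        abs_of_pos hpos, abs_sub_comm x y, sub_sub_sub_cancel_left]
  rcases min_cases (1 : ℝ) |x - y| with ⟨e, -⟩ | ⟨e, -⟩ <;> rw [e]
  · linarith
  · refine h2.trans ?_
    gcongr
    linarith

theorem integrable_ramp (ν : Measure ℝ) [IsFiniteMeasure ν] (p q : ℝ) :
    Integrable (ramp p q) ν :=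
  Integrable.of_bound (continuous_ramp p q).aestronglyMeasurable 1
    (Eventually.of_forall fun y => by
      rw [Real.norm_of_nonneg (ramp_nonneg _ _ _)]; exact ramp_le_one _ _ _)

theorem cdf_le_integral_ramp (ν : Measure ℝ) [IsProbabilityMeasure ν] {p q : ℝ} (h : p < q) :
    cdf ν p ≤ ∫ y, ramp p q y ∂ν := by
  rw [cdf_eq_real, ← integral_indicator_one measurableSet_Iic]
  exact integral_mono ((integrable_const _).indicator measurableSet_Iic) (integrable_ramp ν p q)
    (indicator_Iic_le_ramp h)

theorem integral_ramp_le_cdf (ν : Measure ℝ) [IsProbabilityMeasure ν] {p q : ℝ} (h : p < q) :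
    ∫ y, ramp p q y ∂ν ≤ cdf ν q := by
  rw [cdf_eq_real, ← integral_indicator_one measurableSet_Iic]
  exact integral_mono (integrable_ramp ν p q) ((integrable_const _).indicator measurableSet_Iic)
    (ramp_le_indicator_Iic h)

/-- Convergence of the integrals of countably many continuous bounded functions, which is
implied by weak convergence. -/
def RampTendsto (ν : ℕ → ProbabilityMeasure ℝ) (μ : ProbabilityMeasure ℝ) : Prop :=
  ∀ p q : ℚ, p < q → Tendsto (fun k => ∫ y, ramp p q y ∂(ν k : Measure ℝ)) atTop
    (𝓝 (∫ y, ramp p q y ∂(μ : Measure ℝ)))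

theorem monotoneOn_quantile (ν : Measure ℝ) : MonotoneOn (quantile ν) (Set.Ioo 0 1) :=
  fun _ hu _ hv huv =>
    (quantile_le_iff ν hu _).2 (huv.trans ((quantile_le_iff ν hv _).1 le_rfl))

/-- Almost sure convergence of the quantile functions. -/
theorem RampTendsto.tendsto_quantile {ν : ℕ → ProbabilityMeasure ℝ} {μ : ProbabilityMeasure ℝ}
    (h : RampTendsto ν μ) :
    ∀ᵐ u ∂unif, Tendsto (fun k => quantile (ν k) u) atTop (𝓝 (quantile μ u)) := by
  have hcount := (monotoneOn_quantile (μ : Measure ℝ)).countable_not_continuousWithinAt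
  have hae : ∀ᵐ u ∂unif, u ∉ {x ∈ Set.Ioo (0 : ℝ) 1 |
      ¬ ContinuousWithinAt (quantile μ) (Set.Ioo 0 1) x} := by
    refine measure_eq_zero_iff_ae_notMem.1 ?_
    exact Measure.absolutelyContinuous_of_le Measure.restrict_le_self (hcount.measure_zero volume)
  filter_upwards [hae, ae_restrict_mem measurableSet_Ioo] with u hu hu01
  have hcont : ContinuousAt (quantile μ) u := by
    have : ContinuousWithinAt (quantile μ) (Set.Ioo 0 1) u := by
      by_contra hc; exact hu ⟨hu01, hc⟩
    exact this.continuousAt (Ioo_mem_nhds hu01.1 hu01.2)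
  rw [tendsto_order]
  constructor
  · intro a ha
    -- A ramp between two rationals in the open interval from `a` to the quantile is sandwiched
    -- between distribution functions, so its integral transfers a strict inequality from `μ` to `ν
    -- k`.
    obtain ⟨p, hap, hp⟩ := exists_rat_btwn ha
    obtain ⟨q, hpq, hq⟩ := exists_rat_btwn hp
    have hlt : ∫ y, ramp p q y ∂(μ : Measure ℝ) < u := by
      refine (integral_ramp_le_cdf _ hpq).trans_lt (not_le.1 fun hle => ?_)
      exact hq.not_ge ((quantile_le_iff _ hu01 _).2 hle)
    filter_upwards [(h p q (by exact_mod_cast hpq)).eventually_lt_const hlt] with k hk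
    refine hap.trans (not_le.1 fun hle => ?_)
    exact (((quantile_le_iff _ hu01 _).1 hle).trans (cdf_le_integral_ramp _ hpq)).not_gt hk
  · intro a ha
    -- At `u` itself the quantile only gives a weak inequality for the distribution function.
    -- Continuity at `u` permits passing to a larger `v`, which makes it strict.
    have hev : ∀ᶠ v in 𝓝[>] u, quantile μ v < a ∧ v < 1 :=
      ((hcont.eventually_lt_const ha).and (eventually_lt_nhds hu01.2)).filter_mono
        nhdsWithin_le_nhds
    obtain ⟨v, ⟨hva, hv1⟩, huv⟩ := (hev.and eventually_mem_nhdsWithin).exists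
    have huv' : u < v := huv
    have hv01 : v ∈ Set.Ioo (0 : ℝ) 1 := ⟨hu01.1.trans huv', hv1⟩
    obtain ⟨p, hvp, hp⟩ := exists_rat_btwn hva
    obtain ⟨q, hpq, hq⟩ := exists_rat_btwn hp
    have hlt : u < ∫ y, ramp p q y ∂(μ : Measure ℝ) :=
      huv'.trans_le (((quantile_le_iff _ hv01 _).1 hvp.le).trans (cdf_le_integral_ramp _ hpq))
    filter_upwards [(h p q (by exact_mod_cast hpq)).eventually_const_lt hlt] with k hk
    refine lt_of_le_of_lt ?_ hq
    exact (quantile_le_iff _ hu01 _).2 (hk.le.trans (integral_ramp_le_cdf _ hpq))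

theorem rampTendsto_of_tendsto {ν : ℕ → ProbabilityMeasure ℝ} {μ : ProbabilityMeasure ℝ}
    (h : Tendsto ν atTop (𝓝 μ)) : RampTendsto ν μ := by
  intro p q _
  exact (ProbabilityMeasure.tendsto_iff_forall_integral_tendsto.1 h)
    (BoundedContinuousFunction.ofNormedAddCommGroup (ramp p q) (continuous_ramp p q) 1 fun y => by
      rw [Real.norm_of_nonneg (ramp_nonneg _ _ _)]; exact ramp_le_one _ _ _)

end Quantile

/-! ### Orlicz functionals -/

section Modular

/-- The function `y ↦ Ψ (c |y|)`. -/
def YoungFunction.scaled (Ψ : YoungFunction) (c : ℝ≥0) (y : ℝ) : ℝ≥0 := Ψ.toFun (c * ‖y‖₊)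

variable (Ψ : YoungFunction)

theorem YoungFunction.continuous_scaled (c : ℝ≥0) : Continuous (Ψ.scaled c) :=
  Ψ.continuous.comp (continuous_const.mul continuous_nnnorm)

theorem YoungFunction.measurable_scaled (c : ℝ≥0) : Measurable (Ψ.scaled c) :=
  (Ψ.continuous_scaled c).measurable

@[simp]
theorem YoungFunction.scaled_zero_left (y : ℝ) : Ψ.scaled 0 y = 0 := by
  simp [YoungFunction.scaled, Ψ.map_zero]

@[simp]
theorem YoungFunction.scaled_zero_right (c : ℝ≥0) : Ψ.scaled c 0 = 0 := by
  simp [YoungFunction.scaled, Ψ.map_zero]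

theorem YoungFunction.scaled_mono {c c' : ℝ≥0} {x y : ℝ} (h : c * ‖x‖₊ ≤ c' * ‖y‖₊) :
    Ψ.scaled c x ≤ Ψ.scaled c' y := Ψ.monotone h

/-- The maximum, rather than a sum, allows the same level `R` to be subtracted from both terms in
`YoungFunction.scaled_add_tsub_le`. -/
theorem YoungFunction.scaled_add_le (c : ℝ≥0) (x y : ℝ) :
    Ψ.scaled c (x + y) ≤ max (Ψ.scaled (2 * c) x) (Ψ.scaled (2 * c) y) := by
  have hn : c * ‖x + y‖₊ ≤ c * (‖x‖₊ + ‖y‖₊) := by gcongr; exact nnnorm_add_le _ _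
  rcases le_total ‖x‖₊ ‖y‖₊ with h | h
  · refine le_max_of_le_right (Ψ.scaled_mono (hn.trans ?_))
    calc c * (‖x‖₊ + ‖y‖₊) ≤ c * (‖y‖₊ + ‖y‖₊) := by gcongr
      _ = 2 * c * ‖y‖₊ := by ring
  · refine le_max_of_le_left (Ψ.scaled_mono (hn.trans ?_))
    calc c * (‖x‖₊ + ‖y‖₊) ≤ c * (‖x‖₊ + ‖x‖₊) := by gcongr
      _ = 2 * c * ‖x‖₊ := by ring

theorem YoungFunction.scaled_add_tsub_le (c : ℝ≥0) (x y : ℝ) (R : ℝ≥0) :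
    Ψ.scaled c (x + y) - R ≤ (Ψ.scaled (2 * c) x - R) + (Ψ.scaled (2 * c) y - R) := by
  refine (tsub_le_tsub_right (Ψ.scaled_add_le c x y) R).trans ?_
  rcases max_cases (Ψ.scaled (2 * c) x) (Ψ.scaled (2 * c) y) with ⟨e, -⟩ | ⟨e, -⟩ <;> rw [e]
  · exact le_self_add
  · exact le_add_self

theorem YoungFunction.scaled_neg (c : ℝ≥0) (y : ℝ) : Ψ.scaled c (-y) = Ψ.scaled c y := by
  simp [YoungFunction.scaled]

theorem YoungFunction.scaled_sub_tsub_le (c : ℝ≥0) (x y : ℝ) (R : ℝ≥0) :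
    Ψ.scaled c (x - y) - R ≤ (Ψ.scaled (2 * c) x - R) + (Ψ.scaled (2 * c) y - R) := by
  rw [sub_eq_add_neg, ← Ψ.scaled_neg (2 * c) y]
  exact Ψ.scaled_add_tsub_le c x (-y) R

/-- The excess over high levels of an integrable function has a small integral. -/
theorem tendsto_lintegral_tsub_natCast {α : Type*} [MeasurableSpace α] {m : Measure α}
    {f : α → ℝ≥0} (hf : Measurable f) (hfin : ∫⁻ a, f a ∂m < ∞) :
    Tendsto (fun R : ℕ => ∫⁻ a, (f a - (R : ℝ≥0) : ℝ≥0) ∂m) atTop (𝓝 0) := by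
  rw [← lintegral_zero (μ := m)]
  refine tendsto_lintegral_of_dominated_convergence (fun a => (f a : ℝ≥0∞))
    (fun R => (hf.sub_const _).coe_nnreal_ennreal)
    (fun R => Eventually.of_forall fun a => ENNReal.coe_le_coe.2 tsub_le_self) hfin.ne
    (Eventually.of_forall fun a => ?_)
  refine tendsto_const_nhds.congr' ?_
  obtain ⟨N, hN⟩ := exists_nat_ge (f a)
  filter_upwards [eventually_ge_atTop N] with n hn
  have : f a ≤ (n : ℝ≥0) := hN.trans (by exact_mod_cast hn)
  simp [tsub_eq_zero_of_le this]

theorem exists_lintegral_tsub_le {α : Type*} [MeasurableSpace α] {m : Measure α} {f : α → ℝ≥0}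
    (hf : Measurable f) (hfin : ∫⁻ a, f a ∂m < ∞) {ε : ℝ≥0∞} (hε : 0 < ε) :
    ∃ R : ℕ, ∫⁻ a, (f a - (R : ℝ≥0) : ℝ≥0) ∂m ≤ ε :=
  ((ENNReal.tendsto_nhds_zero.1 (tendsto_lintegral_tsub_natCast hf hfin)) ε hε).exists

theorem lintegral_tsub_antitone {α : Type*} [MeasurableSpace α] (m : Measure α) (f : α → ℝ≥0)
    {R R' : ℝ≥0} (h : R ≤ R') :
    ∫⁻ a, (f a - R' : ℝ≥0) ∂m ≤ ∫⁻ a, (f a - R : ℝ≥0) ∂m :=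
  lintegral_mono fun _ => ENNReal.coe_le_coe.2 (tsub_le_tsub_left h _)

/-- All moments `∫ Ψ(c|y|) dμ(y)` are finite. -/
def HasFiniteMoments (μ : Measure ℝ) : Prop := ∀ c : ℝ≥0, ∫⁻ y, Ψ.scaled c y ∂μ < ∞

/-- The tails of all moments `∫ Ψ(c|y|) dν_k(y)` are asymptotically uniformly small. -/
def UniformTails (ν : ℕ → ProbabilityMeasure ℝ) : Prop :=
  ∀ (c : ℝ≥0) (ε : ℝ≥0∞), 0 < ε → ∃ R : ℝ≥0, ∀ᶠ k in atTop,
    ∫⁻ y, (Ψ.scaled c y - R : ℝ≥0) ∂(ν k : Measure ℝ) ≤ ε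

variable {Ψ}

theorem lintegral_quantile (μ : ProbabilityMeasure ℝ) {f : ℝ → ℝ≥0∞} (hf : Measurable f) :
    ∫⁻ u, f (quantile μ u) ∂unif = ∫⁻ y, f y ∂(μ : Measure ℝ) := by
  conv_rhs => rw [← map_quantile (μ : Measure ℝ)]
  rw [lintegral_map hf (measurable_quantile _)]

/-- Modular convergence of the quantile functions. -/
theorem UniformTails.tendsto_lintegral_quantile {ν : ℕ → ProbabilityMeasure ℝ}
    {μ : ProbabilityMeasure ℝ} (hT : UniformTails Ψ ν) (hW : RampTendsto ν μ)
    (hμ : HasFiniteMoments Ψ μ) (c : ℝ≥0) :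
    Tendsto (fun k => ∫⁻ u, Ψ.scaled c (quantile (ν k) u - quantile μ u) ∂unif) atTop (𝓝 0) := by
  have hmd : ∀ k, Measurable fun u => quantile (ν k : Measure ℝ) u - quantile (μ : Measure ℝ) u :=
    fun k => (measurable_quantile _).sub (measurable_quantile _)
  rw [ENNReal.tendsto_nhds_zero]
  intro ε hε
  have hε3 : 0 < ε / 3 := ENNReal.div_pos hε.ne' (by norm_num)
  obtain ⟨R₁, hR₁⟩ := hT (2 * c) (ε / 3) hε3
  obtain ⟨R₂, hR₂⟩ := exists_lintegral_tsub_le (Ψ.measurable_scaled (2 * c)) (hμ (2 * c)) hε3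
  set R : ℝ≥0 := max R₁ R₂ with hR
  -- The part truncated at `R` vanishes by dominated convergence; the excess over `R` splits into
  -- the excesses of the two laws at scale `2 * c`.
  have hmin : Tendsto (fun k => ∫⁻ u, (min (Ψ.scaled c (quantile (ν k) u - quantile μ u)) R : ℝ≥0)
      ∂unif) atTop (𝓝 (∫⁻ _, 0 ∂unif)) := by
    refine tendsto_lintegral_of_dominated_convergence (fun _ => (R : ℝ≥0∞))
      (fun k => (((Ψ.measurable_scaled c).comp (hmd k)).min measurable_const).coe_nnreal_ennreal)
      (fun k => Eventually.of_forall fun u => ENNReal.coe_le_coe.2 (min_le_right _ _)) (by simp) ?_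
    filter_upwards [hW.tendsto_quantile] with u hu
    have h1 : Tendsto (fun k => quantile (ν k) u - quantile μ u) atTop (𝓝 0) := by
      simpa using hu.sub_const (quantile μ u)
    have h2 : Tendsto (fun k => Ψ.scaled c (quantile (ν k) u - quantile μ u)) atTop (𝓝 0) := by
      have := ((Ψ.continuous_scaled c).tendsto 0).comp h1
      rwa [Ψ.scaled_zero_right] at this
    have h3 := h2.min (tendsto_const_nhds (x := R))
    rw [min_eq_left (zero_le : 0 ≤ R)] at h3
    exact ENNReal.tendsto_coe.2 h3
  rw [lintegral_zero] at hmin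
  filter_upwards [hR₁, (ENNReal.tendsto_nhds_zero.1 hmin) _ hε3] with k hk1 hk2
  have hm2 : ∀ κ : ProbabilityMeasure ℝ,
      Measurable fun u => ((Ψ.scaled (2 * c) (quantile κ u) - R : ℝ≥0) : ℝ≥0∞) := fun κ =>
    (((Ψ.measurable_scaled _).comp (measurable_quantile _)).sub_const R).coe_nnreal_ennreal
  have hm1 : Measurable fun y => ((Ψ.scaled (2 * c) y - R : ℝ≥0) : ℝ≥0∞) :=
    ((Ψ.measurable_scaled _).sub_const R).coe_nnreal_ennreal
  calc ∫⁻ u, Ψ.scaled c (quantile (ν k) u - quantile μ u) ∂unif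
      ≤ ∫⁻ u, ((min (Ψ.scaled c (quantile (ν k) u - quantile μ u)) R : ℝ≥0) +
          (((Ψ.scaled (2 * c) (quantile (ν k) u) - R : ℝ≥0) : ℝ≥0∞) +
            ((Ψ.scaled (2 * c) (quantile μ u) - R : ℝ≥0) : ℝ≥0∞))) ∂unif := by
        refine lintegral_mono fun u => ?_
        rw [← ENNReal.coe_add, ← ENNReal.coe_add, ENNReal.coe_le_coe]
        set a := Ψ.scaled c (quantile (ν k) u - quantile μ u)
        calc a ≤ min a R + (a - R) := by
              rcases le_total a R with h | h
              · rw [min_eq_left h]; exact le_self_add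
              · rw [min_eq_right h, add_tsub_cancel_of_le h]
          _ ≤ _ := add_le_add_right (Ψ.scaled_sub_tsub_le c _ _ R) _
    _ ≤ ε / 3 + (ε / 3 + ε / 3) := by
        rw [lintegral_add_right _ (show Measurable fun u => _ + _ from (hm2 _).add (hm2 _)),
          lintegral_add_right _ (hm2 _),
          lintegral_quantile (ν k) hm1, lintegral_quantile μ hm1]
        gcongr
        · exact (lintegral_tsub_antitone _ _ (le_max_left _ _)).trans hk1
        · exact (lintegral_tsub_antitone _ _ (le_max_right _ _)).trans hR₂
    _ = ε := by rw [← add_assoc, ENNReal.add_thirds]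

end Modular

/-! ### Continuity of risk measures -/

section Continuity

variable {Ω : Type*} [MeasurableSpace Ω] {P : Measure Ω} {Ψ : YoungFunction}

theorem lintegral_scaled_lt_top_of_mem_orliczHeart (X : orliczHeart Ψ P) (c : ℝ≥0) :
    ∫⁻ ω, Ψ.scaled c ((X : Ω →ₘ[P] ℝ) ω) ∂P < ∞ := by
  rcases eq_zero_or_pos c with rfl | hc
  · simp
  · exact X.2 c hc

theorem mk_mem_orliczHeart {f : Ω → ℝ} (hf : AEStronglyMeasurable f P)
    (h : ∀ c : ℝ≥0, 0 < c → ∫⁻ ω, Ψ.scaled c (f ω) ∂P < ∞) :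
    AEEqFun.mk f hf ∈ orliczHeart Ψ P := by
  intro c hc
  refine (lintegral_congr_ae ?_).trans_lt (h c hc)
  filter_upwards [AEEqFun.coeFn_mk f hf] with ω hω
  rw [hω, YoungFunction.scaled]

/-- A sequence that converges rapidly to zero in the modular sense is dominated, up to a null
sequence of factors, by an element of the Orlicz heart. -/
theorem exists_orliczHeart_ge_mul (Z : ℕ → orliczHeart Ψ P)
    (hZ : ∀ j : ℕ, ∫⁻ ω, Ψ.scaled (j * j) ((Z j : Ω →ₘ[P] ℝ) ω) ∂P ≤ 2⁻¹ ^ j) :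
    ∃ W : orliczHeart Ψ P, ∀ᵐ ω ∂P, ∀ j : ℕ,
      j * |(Z j : Ω →ₘ[P] ℝ) ω| ≤ (W : Ω →ₘ[P] ℝ) ω := by
  have hmeas : ∀ (j : ℕ) (c : ℝ≥0),
      Measurable fun ω => (Ψ.scaled c ((Z j : Ω →ₘ[P] ℝ) ω) : ℝ≥0∞) := fun j c =>
    ((Ψ.measurable_scaled c).comp
      (AEEqFun.stronglyMeasurable (Z j : Ω →ₘ[P] ℝ)).measurable).coe_nnreal_ennreal
  have hsum : ∀ c : ℝ≥0,
      ∫⁻ ω, ∑' j : ℕ, (Ψ.scaled (c * j) ((Z j : Ω →ₘ[P] ℝ) ω) : ℝ≥0∞) ∂P < ∞ := by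
    intro c
    rw [lintegral_tsum fun j => (hmeas j _).aemeasurable]
    -- For `j ≥ N` one has `c * j ≤ j * j`, so the hypothesis gives a geometric bound; this is why
    -- the scale there is `j * j`. The finitely many earlier terms are finite by membership in the
    -- heart.
    obtain ⟨N, hN⟩ := exists_nat_ge c
    have hfin : ∀ j : ℕ, ∫⁻ ω, Ψ.scaled (c * j) ((Z j : Ω →ₘ[P] ℝ) ω) ∂P < ∞ := fun j =>
      lintegral_scaled_lt_top_of_mem_orliczHeart (Z j) _
    let a : ℕ → ℝ≥0∞ := fun j => ∫⁻ ω, Ψ.scaled (c * j) ((Z j : Ω →ₘ[P] ℝ) ω) ∂P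
    change ∑' j, a j < ∞
    have hsplit := Summable.sum_add_tsum_nat_add' (f := a) (k := N) ENNReal.summable
    rw [← hsplit]
    refine ENNReal.add_lt_top.2 ⟨ENNReal.sum_lt_top.2 fun j _ => hfin j, ?_⟩
    have hle : ∀ j : ℕ, ∫⁻ ω, Ψ.scaled (c * (j + N : ℕ)) ((Z (j + N) : Ω →ₘ[P] ℝ) ω) ∂P ≤
        (2⁻¹ : ℝ≥0∞) ^ j := fun j => by
      have hc : c ≤ ((j + N : ℕ) : ℝ≥0) := hN.trans (by exact_mod_cast Nat.le_add_left N j)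
      calc ∫⁻ ω, Ψ.scaled (c * (j + N : ℕ)) ((Z (j + N) : Ω →ₘ[P] ℝ) ω) ∂P
          ≤ ∫⁻ ω, Ψ.scaled ((j + N : ℕ) * (j + N : ℕ)) ((Z (j + N) : Ω →ₘ[P] ℝ) ω) ∂P :=
            lintegral_mono fun ω => ENNReal.coe_le_coe.2 (Ψ.scaled_mono (by gcongr))
        _ ≤ (2⁻¹ : ℝ≥0∞) ^ (j + N) := hZ (j + N)
        _ ≤ (2⁻¹ : ℝ≥0∞) ^ j :=
            pow_le_pow_right_of_le_one' (by simp) (Nat.le_add_right _ _)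
    refine lt_of_le_of_lt (ENNReal.tsum_le_tsum hle) ?_
    rw [ENNReal.tsum_geometric_two]
    exact ENNReal.ofNat_lt_top
  have hbdd : ∀ᵐ ω ∂P, BddAbove (Set.range fun j : ℕ => (j : ℝ) * |(Z j : Ω →ₘ[P] ℝ) ω|) := by
    filter_upwards [ae_lt_top' (AEMeasurable.tsum fun j => (hmeas j _).aemeasurable)
      (hsum 1).ne] with ω hω
    set K := ∑' j : ℕ, (Ψ.scaled (1 * j) ((Z j : Ω →ₘ[P] ℝ) ω) : ℝ≥0∞) with hK
    -- Since `Ψ` tends to infinity, a bound on all `Ψ (j |Z j|)` bounds the arguments `j |Z j|`.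
    obtain ⟨M, hM⟩ := (Ψ.tendsto_atTop.eventually_gt_atTop K.toNNReal).exists
    refine ⟨M, ?_⟩
    rintro _ ⟨j, rfl⟩
    have hj : Ψ.toFun (j * ‖(Z j : Ω →ₘ[P] ℝ) ω‖₊) ≤ K.toNNReal := by
      rw [← ENNReal.coe_le_coe, ENNReal.coe_toNNReal hω.ne]
      have := ENNReal.le_tsum (f := fun j : ℕ =>
        (Ψ.scaled (1 * j) ((Z j : Ω →ₘ[P] ℝ) ω) : ℝ≥0∞)) j
      simpa only [YoungFunction.scaled, one_mul, hK] using this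
    have hlt : (j : ℝ≥0) * ‖(Z j : Ω →ₘ[P] ℝ) ω‖₊ ≤ M :=
      not_lt.1 fun h => (hj.trans_lt hM).not_ge (Ψ.monotone h.le)
    have := NNReal.coe_le_coe.2 hlt
    simpa using this
  let w : Ω → ℝ := fun ω => ⨆ j : ℕ, (j : ℝ) * |(Z j : Ω →ₘ[P] ℝ) ω|
  have hwm : AEStronglyMeasurable w P :=
    (Measurable.iSup fun j => measurable_const.mul
      (AEEqFun.stronglyMeasurable (Z j : Ω →ₘ[P] ℝ)).measurable.abs).aestronglyMeasurable
  have hw0 : ∀ ω, 0 ≤ w ω := fun ω => Real.iSup_nonneg fun j => by positivity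
  have hwH : AEEqFun.mk w hwm ∈ orliczHeart Ψ P := by
    refine mk_mem_orliczHeart hwm fun c _ => (lintegral_mono_ae ?_).trans_lt (hsum c)
    filter_upwards [hbdd] with ω hω
    -- Being monotone and continuous, `g` commutes with the supremum; the supremum of the `Ψ (c j |Z
    -- j|)` is then dominated by their integrable sum.
    let g : ℝ → ℝ≥0∞ := fun x => (Ψ.toFun (c * x.toNNReal) : ℝ≥0∞)
    have hgm : Monotone g := fun x y hxy =>
      ENNReal.coe_le_coe.2 (Ψ.monotone (by gcongr))
    have hgc : Continuous g := ENNReal.continuous_coe.comp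
      (Ψ.continuous.comp (continuous_const.mul continuous_real_toNNReal))
    have hg : ∀ x, 0 ≤ x → (Ψ.scaled c x : ℝ≥0∞) = g x := fun x hx => by
      simp only [g, YoungFunction.scaled, Real.toNNReal_eq_nnnorm_of_nonneg hx]
    rw [hg _ (hw0 ω), hgm.map_ciSup_of_continuousAt hgc.continuousAt hω]
    refine iSup_le fun j => ?_
    refine le_trans (le_of_eq ?_) (ENNReal.le_tsum j)
    rw [← hg _ (by positivity)]
    simp [YoungFunction.scaled, mul_assoc]
  refine ⟨⟨_, hwH⟩, ?_⟩
  filter_upwards [hbdd, AEEqFun.coeFn_mk w hwm] with ω hω hmk j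
  rw [hmk]
  exact le_ciSup hω j

/-- A risk measure is continuous along every line. -/
theorem RiskMeasure.continuous_line (ρ : RiskMeasure Ψ P) (Y W : orliczHeart Ψ P) :
    Continuous fun t : ℝ => ρ.toFun (Y + t • W) := by
  have hconv : ConvexOn ℝ Set.univ fun t : ℝ => ρ.toFun (Y + t • W) := by
    refine ⟨convex_univ, fun x _ y _ a b ha hb hab => ?_⟩
    have hb' : b = 1 - a := by linarith
    have := ρ.convex (Y + x • W) (Y + y • W) a ha (by linarith)
    rw [← hb'] at this
    refine le_trans (le_of_eq ?_) this
    refine congrArg ρ.toFun ?_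
    calc Y + (a • x + b • y) • W = (a + b) • Y + (a • x + b • y) • W := by rw [hab, one_smul]
      _ = a • (Y + x • W) + b • (Y + y • W) := by
        simp only [smul_eq_mul]; module
  exact continuousOn_univ.1 (hconv.continuousOn isOpen_univ)

/-- A convex monotone functional on the Orlicz heart is continuous for modular convergence. -/
theorem RiskMeasure.tendsto_of_modular (ρ : RiskMeasure Ψ P) (X : ℕ → orliczHeart Ψ P)
    (Y : orliczHeart Ψ P)
    (h : ∀ c : ℝ≥0, Tendsto (fun k => ∫⁻ ω,
      Ψ.scaled c ((X k : Ω →ₘ[P] ℝ) ω - (Y : Ω →ₘ[P] ℝ) ω) ∂P) atTop (𝓝 0)) :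
    Tendsto (fun k => ρ.toFun (X k)) atTop (𝓝 (ρ.toFun Y)) := by
  refine tendsto_of_subseq_tendsto fun ns hns => ?_
  obtain ⟨ms, -, hms⟩ := extraction_forall_of_eventually (P := fun j k => ∫⁻ ω,
      Ψ.scaled (j * j) ((X (ns k) : Ω →ₘ[P] ℝ) ω - (Y : Ω →ₘ[P] ℝ) ω) ∂P ≤ 2⁻¹ ^ j)
    (fun j => (ENNReal.tendsto_nhds_zero.1 ((h (j * j)).comp hns)) (2⁻¹ ^ j)
      (ENNReal.pow_pos (by simp) j))
  refine ⟨ms, ?_⟩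
  have hsub : ∀ j, ((X (ns (ms j)) - Y : orliczHeart Ψ P) : Ω →ₘ[P] ℝ) =ᵐ[P]
      fun ω => (X (ns (ms j)) : Ω →ₘ[P] ℝ) ω - (Y : Ω →ₘ[P] ℝ) ω := fun j =>
    AEEqFun.coeFn_sub _ _
  obtain ⟨W, hW⟩ := exists_orliczHeart_ge_mul (fun j => X (ns (ms j)) - Y) fun j => by
    refine (lintegral_congr_ae ?_).trans_le (hms j)
    filter_upwards [hsub j] with ω hω
    rw [hω]
  have hline : ∀ t : ℝ, ((Y + t • W : orliczHeart Ψ P) : Ω →ₘ[P] ℝ) =ᵐ[P]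
      fun ω => (Y : Ω →ₘ[P] ℝ) ω + t * (W : Ω →ₘ[P] ℝ) ω := fun t => by
    filter_upwards [AEEqFun.coeFn_add (Y : Ω →ₘ[P] ℝ) (t • (W : Ω →ₘ[P] ℝ)),
      AEEqFun.coeFn_smul t (W : Ω →ₘ[P] ℝ)] with ω h1 h2
    change ((Y : Ω →ₘ[P] ℝ) + t • (W : Ω →ₘ[P] ℝ)) ω = _
    rw [h1, Pi.add_apply, h2, Pi.smul_apply, smul_eq_mul]
  have hcont := ρ.continuous_line Y W
  have ht : Tendsto (fun j : ℕ => ((j : ℝ))⁻¹) atTop (𝓝 0) := tendsto_inv_atTop_nhds_zero_nat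
  have hup : Tendsto (fun j : ℕ => ρ.toFun (Y + (-(j : ℝ)⁻¹) • W)) atTop (𝓝 (ρ.toFun Y)) := by
    have := (hcont.tendsto (-0)).comp ht.neg
    simpa [Function.comp_def] using this
  have hlo : Tendsto (fun j : ℕ => ρ.toFun (Y + ((j : ℝ)⁻¹) • W)) atTop (𝓝 (ρ.toFun Y)) := by
    have := (hcont.tendsto 0).comp ht
    simpa [Function.comp_def] using this
  have hbound : ∀ j : ℕ, 0 < j → ∀ᵐ ω ∂P, |(X (ns (ms j)) : Ω →ₘ[P] ℝ) ω - (Y : Ω →ₘ[P] ℝ) ω| ≤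
      (j : ℝ)⁻¹ * (W : Ω →ₘ[P] ℝ) ω := fun j hj => by
    filter_upwards [hsub j, hW] with ω h1 h2
    have := h2 j
    rw [h1] at this
    rwa [le_inv_mul_iff₀ (by exact_mod_cast hj)]
  -- As `ρ` is antitone, the upper bound `Y + W / j` of the variable gives the lower bound of the
  -- risk.
  refine tendsto_of_tendsto_of_tendsto_of_le_of_le' hlo hup ?_ ?_
  · filter_upwards [eventually_gt_atTop 0] with j hj
    refine ρ.antitone _ _ ?_
    filter_upwards [hline (j : ℝ)⁻¹, hbound j hj] with ω h1 h2
    rw [h1]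
    linarith [(abs_le.1 h2).2]
  · filter_upwards [eventually_gt_atTop 0] with j hj
    refine ρ.antitone _ _ ?_
    filter_upwards [hline (-(j : ℝ)⁻¹), hbound j hj] with ω h1 h2
    rw [h1]
    linarith [(abs_le.1 h2).1]

theorem hasFiniteMoments_of_mem_laws {μ : ProbabilityMeasure ℝ} (h : μ ∈ laws Ψ P) :
    HasFiniteMoments Ψ μ := by
  obtain ⟨X, hX⟩ := h
  intro c
  rw [← hX, lintegral_map (Ψ.measurable_scaled c).coe_nnreal_ennreal
    (AEEqFun.stronglyMeasurable (X : Ω →ₘ[P] ℝ)).measurable]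
  exact lintegral_scaled_lt_top_of_mem_orliczHeart X c

theorem exists_orliczHeart_quantile {U : Ω → ℝ} (hU : Measurable U) (hUP : P.map U = unif)
    {μ : ProbabilityMeasure ℝ} (h : HasFiniteMoments Ψ μ) :
    ∃ X : orliczHeart Ψ P, (X : Ω →ₘ[P] ℝ) =ᵐ[P] (fun ω => quantile μ (U ω)) ∧
      P.map (X : Ω →ₘ[P] ℝ) = (μ : Measure ℝ) := by
  have hm : Measurable fun ω => quantile (μ : Measure ℝ) (U ω) := (measurable_quantile _).comp hU
  have hmem : AEEqFun.mk _ hm.aestronglyMeasurable ∈ orliczHeart Ψ P := by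
    refine mk_mem_orliczHeart _ fun c _ => ?_
    rw [← lintegral_map (f := fun u => (Ψ.scaled c (quantile (μ : Measure ℝ) u) : ℝ≥0∞))
      ((Ψ.measurable_scaled c).comp (measurable_quantile _)).coe_nnreal_ennreal hU, hUP,
      lintegral_quantile μ (Ψ.measurable_scaled c).coe_nnreal_ennreal]
    exact h c
  have hae := AEEqFun.coeFn_mk _ hm.aestronglyMeasurable (μ := P)
  refine ⟨⟨_, hmem⟩, hae, ?_⟩
  change P.map (AEEqFun.mk _ hm.aestronglyMeasurable : Ω →ₘ[P] ℝ) = _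
  rw [Measure.map_congr hae]
  have := map_quantile (μ : Measure ℝ)
  rwa [← hUP, Measure.map_map (measurable_quantile _) hU] at this

/-- Atomlessness makes the space rich enough to realise every law with finite moments, through its
quantile function at a uniform variable. -/
theorem mem_laws_iff [IsProbabilityMeasure P] (hP : IsAtomless P) {μ : ProbabilityMeasure ℝ} :
    μ ∈ laws Ψ P ↔ HasFiniteMoments Ψ μ := by
  refine ⟨hasFiniteMoments_of_mem_laws, fun h => ?_⟩
  obtain ⟨U, hU, hUP⟩ := hP.exists_uniform
  obtain ⟨X, -, hX⟩ := exists_orliczHeart_quantile hU hUP h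
  exact ⟨X, hX⟩

/-- Sequential continuity of the risk functional for weak convergence with uniform tails. -/
theorem tendsto_riskFunctional [IsProbabilityMeasure P] (hP : IsAtomless P) (ρ : RiskMeasure Ψ P)
    {ν : ℕ → laws Ψ P} {μ : laws Ψ P} (hW : RampTendsto (fun k => ν k) μ)
    (hT : UniformTails Ψ fun k => ν k) :
    Tendsto (fun k => riskFunctional ρ (ν k)) atTop (𝓝 (riskFunctional ρ μ)) := by
  obtain ⟨U, hU, hUP⟩ := hP.exists_uniform
  have hμ := hasFiniteMoments_of_mem_laws μ.2
  choose X hXq hXl using fun k =>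
    exists_orliczHeart_quantile hU hUP (hasFiniteMoments_of_mem_laws (ν k).2)
  obtain ⟨Y, hYq, hYl⟩ := exists_orliczHeart_quantile hU hUP hμ
  rw [riskFunctional_eq ρ μ Y hYl]
  simp only [fun k => riskFunctional_eq ρ (ν k) (X k) (hXl k)]
  refine ρ.tendsto_of_modular X Y fun c => ?_
  refine (hT.tendsto_lintegral_quantile hW hμ c).congr fun k => ?_
  rw [← hUP, lintegral_map _ hU]
  · refine lintegral_congr_ae ?_
    filter_upwards [hXq k, hYq] with ω h1 h2
    rw [h1, h2]
  · exact ((Ψ.measurable_scaled c).comp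
      ((measurable_quantile _).sub (measurable_quantile _))).coe_nnreal_ennreal

end Continuity

/-! ### Fréchet classes -/

section Frechet

variable {Ψ : YoungFunction} {d : ℕ} {A : (Fin d → ℝ) → ℝ} {μ : Fin d → ProbabilityMeasure ℝ}

/-- Either one coordinate satisfies `|A x| ≤ (d + 1) a |x i|`, and its term alone dominates, or
summing the reverse inequalities over `i` forces `|A x| ≤ (d + 1) b`, where the choice of `R` makes
the excess zero. -/
theorem YoungFunction.scaled_tsub_le_sum_of_growth (Ψ : YoungFunction) {b a : ℝ≥0}
    (hgr : ∀ x : Fin d → ℝ, ‖A x‖₊ ≤ b + a * ∑ i, ‖x i‖₊) (c R : ℝ≥0)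
    (hR : Ψ.toFun (c * ((d + 1) * b)) ≤ R) (x : Fin d → ℝ) :
    Ψ.scaled c (A x) - R ≤ ∑ i, (Ψ.scaled (c * ((d + 1) * a)) (x i) - R) := by
  by_cases h : ∃ i, ‖A x‖₊ ≤ (d + 1) * a * ‖x i‖₊
  · obtain ⟨i, hi⟩ := h
    refine le_trans (tsub_le_tsub_right (Ψ.scaled_mono ?_) R)
      (Finset.single_le_sum (f := fun i => Ψ.scaled (c * ((d + 1) * a)) (x i) - R)
        (fun _ _ => zero_le) (Finset.mem_univ i))
    rw [mul_assoc c]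
    gcongr
  · push Not at h
    have hb : ‖A x‖₊ ≤ (d + 1) * b := by
      by_contra hb
      push Not at hb
      have hs : (d + 1) * a * ∑ i, ‖x i‖₊ ≤ d * ‖A x‖₊ := by
        rw [Finset.mul_sum]
        refine (Finset.sum_le_sum fun i _ => (h i).le).trans ?_
        simp
      have h1 : ((d : ℝ≥0) + 1) * ‖A x‖₊ ≤ (d + 1) * b + d * ‖A x‖₊ := by
        calc ((d : ℝ≥0) + 1) * ‖A x‖₊ ≤ (d + 1) * (b + a * ∑ i, ‖x i‖₊) := by
              gcongr; exact hgr x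
          _ = (d + 1) * b + (d + 1) * a * ∑ i, ‖x i‖₊ := by ring
          _ ≤ _ := by gcongr
      have h2 : (d + 1) * b + d * ‖A x‖₊ < ((d : ℝ≥0) + 1) * ‖A x‖₊ := by
        calc (d + 1) * b + d * ‖A x‖₊ < ‖A x‖₊ + d * ‖A x‖₊ := by gcongr
          _ = _ := by ring
      exact h1.not_gt h2
    have : Ψ.scaled c (A x) ≤ R := (Ψ.monotone (by gcongr)).trans hR
    rw [tsub_eq_zero_of_le this]
    exact zero_le

/-- The tails of the moments are uniformly small on the image of the Fréchet class. -/
theorem exists_lintegral_tsub_le_frechetImage (hA : Measurable A)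
    (hgrowth : ∃ b c : ℝ, 0 < b ∧ 0 < c ∧ ∀ x : Fin d → ℝ, |A x| ≤ b + c * ∑ i, |x i|)
    (hμ : ∀ i, HasFiniteMoments Ψ (μ i)) (c : ℝ≥0) {ε : ℝ≥0∞} (hε : 0 < ε) :
    ∃ R : ℝ≥0, ∀ ν ∈ frechetImage μ A,
      ∫⁻ y, (Ψ.scaled c y - R : ℝ≥0) ∂(ν : Measure ℝ) ≤ ε := by
  obtain ⟨b, a, hb, ha, hgr⟩ := hgrowth
  lift b to ℝ≥0 using hb.le
  lift a to ℝ≥0 using ha.le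
  have hgr' : ∀ x : Fin d → ℝ, ‖A x‖₊ ≤ b + a * ∑ i, ‖x i‖₊ := fun x => by
    rw [← NNReal.coe_le_coe]
    push_cast
    exact hgr x
  set C : ℝ≥0 := c * ((d + 1) * a) with hC
  have ht : Tendsto (fun R : ℕ => ∑ i, ∫⁻ y, (Ψ.scaled C y - (R : ℝ≥0) : ℝ≥0)
      ∂(μ i : Measure ℝ)) atTop (𝓝 0) := by
    have := tendsto_finsetSum Finset.univ fun i (_ : i ∈ Finset.univ) =>
      tendsto_lintegral_tsub_natCast (Ψ.measurable_scaled C) (hμ i C)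
    simpa using this
  obtain ⟨N, hN⟩ := exists_nat_ge (Ψ.toFun (c * ((d + 1) * b)))
  obtain ⟨R, hR, hRN⟩ := (((ENNReal.tendsto_nhds_zero.1 ht) ε hε).and
    (eventually_ge_atTop N)).exists
  refine ⟨R, ?_⟩
  rintro ν ⟨m, hm, hν⟩
  have hmeas : ∀ c' : ℝ≥0, Measurable fun y => ((Ψ.scaled c' y - (R : ℝ≥0) : ℝ≥0) : ℝ≥0∞) :=
    fun c' => ((Ψ.measurable_scaled c').sub_const _).coe_nnreal_ennreal
  rw [hν, lintegral_map (hmeas c) hA]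
  calc ∫⁻ x, (Ψ.scaled c (A x) - (R : ℝ≥0) : ℝ≥0) ∂(m : Measure (Fin d → ℝ))
      ≤ ∫⁻ x, ∑ i, ((Ψ.scaled C (x i) - (R : ℝ≥0) : ℝ≥0) : ℝ≥0∞) ∂(m : Measure (Fin d → ℝ)) := by
        refine lintegral_mono fun x => ?_
        rw [← ENNReal.ofNNReal_finsetSum, ENNReal.coe_le_coe]
        exact Ψ.scaled_tsub_le_sum_of_growth hgr' c R (hN.trans (by exact_mod_cast hRN)) x
    _ = ∑ i, ∫⁻ y, (Ψ.scaled C y - (R : ℝ≥0) : ℝ≥0) ∂(μ i : Measure ℝ) := by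
        rw [lintegral_finsetSum _ fun i _ => show Measurable fun x : Fin d → ℝ =>
          ((Ψ.scaled C (x i) - (R : ℝ≥0) : ℝ≥0) : ℝ≥0∞) from
            (hmeas C).comp (measurable_pi_apply i)]
        refine Finset.sum_congr rfl fun i _ => ?_
        rw [← hm i, lintegral_map (hmeas C) (measurable_pi_apply i)]
    _ ≤ ε := hR

theorem hasFiniteMoments_of_lintegral_tsub {ν : ProbabilityMeasure ℝ}
    (h : ∀ c : ℝ≥0, ∃ R : ℝ≥0, ∫⁻ y, (Ψ.scaled c y - R : ℝ≥0) ∂(ν : Measure ℝ) < ∞) :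
    HasFiniteMoments Ψ ν := by
  intro c
  obtain ⟨R, hR⟩ := h c
  calc ∫⁻ y, Ψ.scaled c y ∂(ν : Measure ℝ)
      ≤ ∫⁻ y, (((Ψ.scaled c y - R : ℝ≥0) : ℝ≥0∞) + R) ∂(ν : Measure ℝ) := by
        refine lintegral_mono fun y => ?_
        rw [← ENNReal.coe_add, ENNReal.coe_le_coe]
        exact le_tsub_add
    _ < ∞ := by
        rw [lintegral_add_right _ measurable_const]
        simpa using hR

end Frechet

/-! ### Empirical measures -/

section Empirical

theorem lintegral_empiricalMeasure (n : ℕ+) (x : ℕ → ℝ) (f : ℝ → ℝ≥0) :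
    ∫⁻ y, f y ∂(empiricalMeasure n x : Measure ℝ) =
      ((n : ℝ≥0)⁻¹ * ∑ i ∈ Finset.range n, f (x i) : ℝ≥0) := by
  have hn : ((n : ℕ) : ℝ≥0) ≠ 0 := by simp
  change ∫⁻ y, f y ∂(((n : ℕ) : ℝ≥0∞)⁻¹ • ∑ i ∈ Finset.range n, Measure.dirac (x i)) = _
  rw [lintegral_smul_measure, lintegral_finsetSum_measure]
  simp only [lintegral_dirac, smul_eq_mul]
  rw [ENNReal.coe_mul, ENNReal.coe_inv hn, ENNReal.ofNNReal_finsetSum, ENNReal.coe_natCast]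

theorem integral_empiricalMeasure (n : ℕ+) (x : ℕ → ℝ) {f : ℝ → ℝ} :
    ∫ y, f y ∂(empiricalMeasure n x : Measure ℝ) =
      (n : ℝ)⁻¹ * ∑ i ∈ Finset.range n, f (x i) := by
  change ∫ y, f y ∂(((n : ℕ) : ℝ≥0∞)⁻¹ • ∑ i ∈ Finset.range n, Measure.dirac (x i)) = _
  rw [integral_smul_measure, integral_finsetSum_measure]
  · simp
  · exact fun i _ => integrable_dirac (by simp)

variable {Ψ : YoungFunction}

theorem hasFiniteMoments_empiricalMeasure (n : ℕ+) (x : ℕ → ℝ) :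
    HasFiniteMoments Ψ (empiricalMeasure n x : Measure ℝ) := by
  intro c
  rw [lintegral_empiricalMeasure]
  exact ENNReal.coe_lt_top

/-- The average of `Ψ (c |x_i - y_i|)` over the first `n` indices. -/
def meanGap (Ψ : YoungFunction) (c : ℝ≥0) (n : ℕ+) (x y : ℕ → ℝ) : ℝ≥0 :=
  (n : ℝ≥0)⁻¹ * ∑ i ∈ Finset.range n, Ψ.scaled c (x i - y i)

variable {n : ℕ → ℕ+} {x y : ℕ → ℕ → ℝ} {κ : ProbabilityMeasure ℝ}

/-- Writing `x = y + (x - y)`, the excess for `x` is at most the excess for `y` plus the mean gap,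
both at scale `2 * c`. -/
theorem UniformTails.of_meanGap (hT : UniformTails Ψ fun k => empiricalMeasure (n k) (y k))
    (hS : ∀ c : ℝ≥0, Tendsto (fun k => meanGap Ψ c (n k) (x k) (y k)) atTop (𝓝 0)) :
    UniformTails Ψ fun k => empiricalMeasure (n k) (x k) := by
  intro c ε hε
  have hε2 : 0 < ε / 2 := ENNReal.half_pos hε.ne'
  obtain ⟨R, hR⟩ := hT (2 * c) (ε / 2) hε2
  have hS' : Tendsto (fun k => (meanGap Ψ (2 * c) (n k) (x k) (y k) : ℝ≥0∞)) atTop (𝓝 0) :=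
    ENNReal.tendsto_coe.2 (hS (2 * c))
  refine ⟨R, ?_⟩
  filter_upwards [hR, (ENNReal.tendsto_nhds_zero.1 hS') _ hε2] with k h1 h2
  rw [lintegral_empiricalMeasure (f := fun y => Ψ.scaled (2 * c) y - R)] at h1
  rw [lintegral_empiricalMeasure (f := fun y => Ψ.scaled c y - R)]
  refine le_trans ?_ ((add_le_add h1 h2).trans_eq (ENNReal.add_halves ε))
  rw [← ENNReal.coe_add, ENNReal.coe_le_coe, meanGap, ← mul_add, ← Finset.sum_add_distrib]
  gcongr with i
  have := Ψ.scaled_add_tsub_le c (y k i) (x k i - y k i) R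
  rw [add_sub_cancel] at this
  refine this.trans ?_
  gcongr
  exact tsub_le_self

theorem YoungFunction.exists_min_le_add_scaled (Ψ : YoungFunction) {δ : ℝ} (hδ : 0 < δ) :
    ∃ c : ℝ≥0, ∀ z : ℝ, min 1 |z| ≤ δ + Ψ.scaled c z := by
  obtain ⟨M, hM⟩ := (Ψ.tendsto_atTop.eventually_ge_atTop 1).exists
  lift δ to ℝ≥0 using hδ.le
  -- With `Ψ M ≥ 1`, this scale sends every `|z| ≥ δ` to an argument of at least `M`.
  refine ⟨M / δ, fun z => ?_⟩
  rcases le_total |z| (δ : ℝ) with h | h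
  · exact (min_le_right _ _).trans (h.trans (le_add_of_nonneg_right NNReal.zero_le_coe))
  · refine (min_le_left _ _).trans ?_
    have h1 : M ≤ M / δ * ‖z‖₊ := by
      rw [← NNReal.coe_le_coe]
      push_cast
      rw [div_mul_eq_mul_div, le_div_iff₀ hδ]
      exact mul_le_mul_of_nonneg_left h M.2
    have h2 : (1 : ℝ) ≤ Ψ.scaled (M / δ) z := by
      exact_mod_cast hM.trans (Ψ.monotone h1)
    linarith

/-- Ramps are bounded and Lipschitz, so their averages along `x` and `y` differ by at most a
multiple of an arbitrary `δ` plus a mean gap. -/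
theorem RampTendsto.of_meanGap (hW : RampTendsto (fun k => empiricalMeasure (n k) (y k)) κ)
    (hS : ∀ c : ℝ≥0, Tendsto (fun k => meanGap Ψ c (n k) (x k) (y k)) atTop (𝓝 0)) :
    RampTendsto (fun k => empiricalMeasure (n k) (x k)) κ := by
  intro p q hpq
  have hpq' : (p : ℝ) < q := by exact_mod_cast hpq
  set L : ℝ := 1 + ((q : ℝ) - p)⁻¹ with hL
  have hLpos : 0 < L := by
    have : 0 < ((q : ℝ) - p)⁻¹ := inv_pos.2 (sub_pos.2 hpq')
    linarith
  have hdiff : Tendsto (fun k => ∫ z, ramp p q z ∂(empiricalMeasure (n k) (x k) : Measure ℝ) -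
      ∫ z, ramp p q z ∂(empiricalMeasure (n k) (y k) : Measure ℝ)) atTop (𝓝 0) := by
    rw [Metric.tendsto_nhds]
    intro ε hε
    have hδ : 0 < ε / L / 2 := by positivity
    obtain ⟨c, hc⟩ := Ψ.exists_min_le_add_scaled hδ
    have hS' : Tendsto (fun k => (meanGap Ψ c (n k) (x k) (y k) : ℝ)) atTop (𝓝 0) := by
      exact NNReal.tendsto_coe.2 (hS c)
    filter_upwards [hS'.eventually_lt_const hδ] with k hk
    have hn : (0 : ℝ) < (n k : ℕ) := by exact_mod_cast (n k).pos
    rw [dist_zero_right, Real.norm_eq_abs, integral_empiricalMeasure, integral_empiricalMeasure,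
      ← mul_sub, ← Finset.sum_sub_distrib, abs_mul, abs_of_pos (inv_pos.2 hn)]
    calc ((n k : ℕ) : ℝ)⁻¹ * |∑ i ∈ Finset.range (n k), (ramp p q (x k i) - ramp p q (y k i))|
        ≤ ((n k : ℕ) : ℝ)⁻¹ * ∑ i ∈ Finset.range (n k),
            L * (ε / L / 2 + Ψ.scaled c (x k i - y k i)) := by
          gcongr
          refine (Finset.abs_sum_le_sum_abs _ _).trans (Finset.sum_le_sum fun i _ => ?_)
          refine (abs_ramp_sub_le hpq' _ _).trans ?_
          gcongr
          exact hc _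
      _ = L * (ε / L / 2 + meanGap Ψ c (n k) (x k) (y k)) := by
          rw [← Finset.mul_sum, Finset.sum_add_distrib, meanGap]
          push_cast
          rw [Finset.sum_const, Finset.card_range, nsmul_eq_mul]
          field_simp
      _ < L * (ε / L / 2 + ε / L / 2) := by gcongr
      _ = ε := by field_simp; ring
  simpa using hdiff.add (hW p q hpq)

theorem UniformTails.const (h : HasFiniteMoments Ψ κ) : UniformTails Ψ fun _ => κ := by
  intro c ε hε
  obtain ⟨R, hR⟩ := exists_lintegral_tsub_le (Ψ.measurable_scaled c) (h c) hε
  exact ⟨R, Eventually.of_forall fun _ => hR⟩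

theorem RampTendsto.const (κ : ProbabilityMeasure ℝ) : RampTendsto (fun _ => κ) κ :=
  fun _ _ _ => tendsto_const_nhds

variable {Ω : Type*} [MeasurableSpace Ω] {P : Measure Ω}

theorem empiricalMeasures_subset_laws [IsProbabilityMeasure P] (hP : IsAtomless P) :
    empiricalMeasures ℝ ⊆ laws Ψ P := by
  rintro _ ⟨n, x, rfl⟩
  exact (mem_laws_iff hP).2 (hasFiniteMoments_empiricalMeasure n x)

theorem tendsto_plugIn [IsProbabilityMeasure P] (hP : IsAtomless P) (ρ : RiskMeasure Ψ P)
    (hE : empiricalMeasures ℝ ⊆ laws Ψ P) {κ : laws Ψ P}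
    (hW : RampTendsto (fun k => empiricalMeasure (n k) (x k)) κ)
    (hT : UniformTails Ψ fun k => empiricalMeasure (n k) (x k)) :
    Tendsto (fun k => plugIn hE (riskFunctional ρ) (n k) (x k)) atTop
      (𝓝 (riskFunctional ρ κ)) :=
  tendsto_riskFunctional hP ρ
    (ν := fun k => ⟨empiricalMeasure (n k) (x k), hE ⟨n k, x k, rfl⟩⟩) hW hT

/-- The difference of plug-in estimates along two arrays of observations with vanishing gap. -/
theorem tendsto_plugIn_sub [IsProbabilityMeasure P] (hP : IsAtomless P) (ρ : RiskMeasure Ψ P)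
    (hE : empiricalMeasures ℝ ⊆ laws Ψ P) {κ : laws Ψ P}
    (hW : RampTendsto (fun k => empiricalMeasure (n k) (y k)) κ)
    (hT : UniformTails Ψ fun k => empiricalMeasure (n k) (y k))
    (hS : ∀ c : ℝ≥0, Tendsto (fun k => meanGap Ψ c (n k) (x k) (y k)) atTop (𝓝 0)) :
    Tendsto (fun k => plugIn hE (riskFunctional ρ) (n k) (x k) -
      plugIn hE (riskFunctional ρ) (n k) (y k)) atTop (𝓝 0) := by
  simpa using (tendsto_plugIn hP ρ hE (hW.of_meanGap hS) (hT.of_meanGap hS)).sub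
    (tendsto_plugIn hP ρ hE hW hT)

theorem continuous_plugIn [IsProbabilityMeasure P] (hP : IsAtomless P) (ρ : RiskMeasure Ψ P)
    (hE : empiricalMeasures ℝ ⊆ laws Ψ P) (n : ℕ+) :
    Continuous (plugIn hE (riskFunctional ρ) n) := by
  refine continuous_iff_seqContinuous.2 fun x y hxy => ?_
  have hS : ∀ c : ℝ≥0, Tendsto (fun k => meanGap Ψ c n (x k) y) atTop (𝓝 0) := by
    intro c
    have hcont : Continuous fun z : ℕ → ℝ => meanGap Ψ c n z y :=
      continuous_const.mul (continuous_finsetSum _ fun i _ =>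
        (Ψ.continuous_scaled c).comp ((continuous_apply i).sub continuous_const))
    have := (hcont.tendsto y).comp hxy
    simpa [meanGap, Function.comp_def] using this
  have := tendsto_plugIn_sub hP ρ hE (n := fun _ => n) (y := fun _ => y)
    (κ := ⟨empiricalMeasure n y, hE ⟨n, y, rfl⟩⟩) (RampTendsto.const _)
    (UniformTails.const (hasFiniteMoments_empiricalMeasure n y)) hS
  simpa [Function.comp_def] using this.add_const (plugIn hE (riskFunctional ρ) n y)

theorem measurable_plugIn [IsProbabilityMeasure P] (hP : IsAtomless P) (ρ : RiskMeasure Ψ P)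
    (hE : empiricalMeasures ℝ ⊆ laws Ψ P) (n : ℕ+) :
    Measurable (plugIn hE (riskFunctional ρ) n) :=
  (continuous_plugIn hP ρ hE n).measurable

end Empirical

/-! ### Couplings and qualitative robustness -/

section Coupling

open ProbabilityTheory

/-- A coupling bounds the Prohorov distance. -/
theorem levyProkhorovDist_map_le {α : Type*} [MeasurableSpace α] {Q : Measure α}
    [IsProbabilityMeasure Q] {f g : α → ℝ} (hf : Measurable f) (hg : Measurable g) {ε : ℝ}
    (hε : 0 ≤ ε) (h : Q {a | ENNReal.ofReal ε ≤ edist (f a) (g a)} ≤ ENNReal.ofReal ε) :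
    levyProkhorovDist (Q.map f) (Q.map g) ≤ ε := by
  have := Measure.isProbabilityMeasure_map (μ := Q) hf.aemeasurable
  have := Measure.isProbabilityMeasure_map (μ := Q) hg.aemeasurable
  refine levyProkhorovDist_le_of_forall_le _ _ hε fun δ B hδ hB => ?_
  rw [Measure.map_apply hf hB, Measure.map_apply hg Metric.isOpen_thickening.measurableSet]
  calc Q (f ⁻¹' B) ≤ Q (g ⁻¹' Metric.thickening δ B ∪
        {a | ENNReal.ofReal ε ≤ edist (f a) (g a)}) := by
        refine measure_mono fun a ha => ?_
        by_cases hle : ENNReal.ofReal ε ≤ edist (f a) (g a)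
        · exact Or.inr hle
        · refine Or.inl ((Metric.mem_thickening_iff_exists_edist_lt _ _).2 ⟨f a, ha, ?_⟩)
          rw [edist_comm]
          exact (not_le.1 hle).trans_le (ENNReal.ofReal_le_ofReal hδ.le)
    _ ≤ Q (g ⁻¹' Metric.thickening δ B) + Q {a | ENNReal.ofReal ε ≤ edist (f a) (g a)} :=
        measure_union_le _ _
    _ ≤ _ := by
        gcongr
        exact h.trans (ENNReal.ofReal_le_ofReal hδ.le)

/-- The infinite product of uniform distributions. -/
def unifSeq : Measure (ℕ → ℝ) := Measure.infinitePi fun _ => unif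

instance : IsProbabilityMeasure unifSeq := inferInstanceAs
  (IsProbabilityMeasure (Measure.infinitePi fun _ : ℕ => unif))

/-- The sequence of independent observations with law `μ` obtained from uniform ones. -/
def sample (μ : ProbabilityMeasure ℝ) (u : ℕ → ℝ) (i : ℕ) : ℝ := quantile μ (u i)

theorem measurable_sample (μ : ProbabilityMeasure ℝ) : Measurable (sample μ) :=
  measurable_pi_lambda _ fun i => (measurable_quantile _).comp (measurable_pi_apply i)

/-- This realises the estimator for every law on the one space of uniform sequences, which provides
the coupling. -/
theorem estimatorLaw_eq_map_sample (μ : ProbabilityMeasure ℝ) {t : (ℕ → ℝ) → ℝ}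
    (ht : Measurable t) : estimatorLaw μ t = unifSeq.map fun u => t (sample μ u) := by
  have h : unifSeq.map (sample μ) = Measure.infinitePi fun _ : ℕ => (μ : Measure ℝ) := by
    have := Measure.infinitePi_map_pi (fun _ : ℕ => unif)
      (f := fun _ => quantile (μ : Measure ℝ)) fun _ => measurable_quantile _
    simp only [map_quantile] at this
    exact this
  rw [estimatorLaw, ← h, Measure.map_map ht (measurable_sample μ)]
  rfl

theorem lintegral_unifSeq_eval (i : ℕ) {f : ℝ → ℝ≥0∞} (hf : Measurable f) :
    ∫⁻ u, f (u i) ∂unifSeq = ∫⁻ v, f v ∂unif :=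
  (measurePreserving_eval_infinitePi (fun _ : ℕ => unif) i).lintegral_comp hf

theorem tendsto_average_sample (μ : ProbabilityMeasure ℝ) {f : ℝ → ℝ} (hf : Measurable f)
    (hi : Integrable f (μ : Measure ℝ)) :
    ∀ᵐ u ∂unifSeq, Tendsto (fun n : ℕ => (∑ i ∈ Finset.range n, f (sample μ u i)) / n) atTop
      (𝓝 (∫ y, f y ∂(μ : Measure ℝ))) := by
  have hg : Measurable fun v => f (quantile (μ : Measure ℝ) v) :=
    hf.comp (measurable_quantile _)
  have hmp : ∀ i, MeasurePreserving (Function.eval i) unifSeq unif := fun i =>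
    measurePreserving_eval_infinitePi (fun _ : ℕ => unif) i
  have hq : MeasurePreserving (quantile (μ : Measure ℝ)) unif (μ : Measure ℝ) :=
    ⟨measurable_quantile _, map_quantile _⟩
  have hmp' : ∀ i, MeasurePreserving (fun u : ℕ → ℝ => quantile (μ : Measure ℝ) (u i)) unifSeq
      (μ : Measure ℝ) := fun i => hq.comp (hmp i)
  have hind := iIndepFun_infinitePi (P := fun _ : ℕ => unif)
    (X := fun (_ : ℕ) v => f (quantile (μ : Measure ℝ) v)) fun _ => hg
  have hlaw : ∀ i, unifSeq.map (fun u : ℕ → ℝ => f (quantile (μ : Measure ℝ) (u i))) =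
      (μ : Measure ℝ).map f := fun i => by
    conv_rhs => rw [← (hmp' i).map_eq, Measure.map_map hf (hmp' i).measurable]
    rfl
  have hslln := strong_law_ae_real (μ := unifSeq)
    (fun i u => f (quantile (μ : Measure ℝ) (u i)))
    ((hmp' 0).integrable_comp hf.aestronglyMeasurable |>.2 hi)
    (fun i j hij => hind.indepFun hij)
    (fun i => ⟨(hg.comp (measurable_pi_apply i)).aemeasurable,
      (hg.comp (measurable_pi_apply 0)).aemeasurable, (hlaw i).trans (hlaw 0).symm⟩)
  have hintegral : ∫ u, f (quantile (μ : Measure ℝ) (u 0)) ∂unifSeq = ∫ y, f y ∂(μ : Measure ℝ) := by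
    conv_rhs => rw [← (hmp' 0).map_eq, integral_map (hmp' 0).measurable.aemeasurable
      hf.aestronglyMeasurable]
  rw [hintegral] at hslln
  exact hslln

variable {Ψ : YoungFunction}

/-- The empirical measures of a sample converge almost surely, with uniform tails. -/
theorem ae_empiricalMeasure_sample {μ : ProbabilityMeasure ℝ} (hμ : HasFiniteMoments Ψ μ)
    {n : ℕ → ℕ+} (hn : Tendsto (fun k => (n k : ℕ)) atTop atTop) :
    ∀ᵐ u ∂unifSeq, RampTendsto (fun k => empiricalMeasure (n k) (sample μ u)) μ ∧
      UniformTails Ψ fun k => empiricalMeasure (n k) (sample μ u) := by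
  have hramp : ∀ᵐ u ∂unifSeq, ∀ p q : ℚ,
      Tendsto (fun n : ℕ => (∑ i ∈ Finset.range n, ramp p q (sample μ u i)) / n) atTop
        (𝓝 (∫ y, ramp p q y ∂(μ : Measure ℝ))) :=
    ae_all_iff.2 fun p => ae_all_iff.2 fun q =>
      tendsto_average_sample μ (continuous_ramp p q).measurable (integrable_ramp _ _ _)
  have hmt : ∀ c R : ℕ, Measurable fun y => Ψ.scaled c y - (R : ℝ≥0) := fun c R =>
    (Ψ.measurable_scaled c).sub_const _
  have hfin : ∀ c R : ℕ, ∫⁻ y, (Ψ.scaled c y - (R : ℝ≥0) : ℝ≥0) ∂(μ : Measure ℝ) < ∞ :=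
    fun c R => (lintegral_mono fun y => ENNReal.coe_le_coe.2 tsub_le_self).trans_lt (hμ c)
  have hintegral : ∀ c R : ℕ, Integrable (fun y => ((Ψ.scaled c y - (R : ℝ≥0) : ℝ≥0) : ℝ))
      (μ : Measure ℝ) := fun c R => by
    refine ⟨(hmt c R).coe_nnreal_real.aestronglyMeasurable, ?_⟩
    rw [hasFiniteIntegral_iff_enorm]
    simpa using hfin c R
  have htail : ∀ᵐ u ∂unifSeq, ∀ c R : ℕ,
      Tendsto (fun n : ℕ => (∑ i ∈ Finset.range n,
        ((Ψ.scaled c (sample μ u i) - (R : ℝ≥0) : ℝ≥0) : ℝ)) / n) atTop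
        (𝓝 (∫ y, ((Ψ.scaled c y - (R : ℝ≥0) : ℝ≥0) : ℝ) ∂(μ : Measure ℝ))) :=
    ae_all_iff.2 fun c => ae_all_iff.2 fun R =>
      tendsto_average_sample μ (hmt c R).coe_nnreal_real (hintegral c R)
  filter_upwards [hramp, htail] with u h1 h2
  refine ⟨fun p q _ => ?_, fun c ε hε => ?_⟩
  · refine ((h1 p q).comp hn).congr fun k => ?_
    rw [integral_empiricalMeasure, Function.comp_apply, div_eq_inv_mul]
  · obtain ⟨N, hN⟩ := exists_nat_ge c
    obtain ⟨δ, hδ0, hδε⟩ := exists_between hε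
    obtain ⟨R, hR⟩ := exists_lintegral_tsub_le (Ψ.measurable_scaled N) (hμ N) hδ0
    refine ⟨R, ?_⟩
    have hlim := ENNReal.tendsto_ofReal ((h2 N R).comp hn)
    have heq : ENNReal.ofReal (∫ y, ((Ψ.scaled N y - (R : ℝ≥0) : ℝ≥0) : ℝ) ∂(μ : Measure ℝ)) =
        ∫⁻ y, (Ψ.scaled N y - (R : ℝ≥0) : ℝ≥0) ∂(μ : Measure ℝ) := by
      rw [ofReal_integral_eq_lintegral_ofReal (hintegral N R)
        (Eventually.of_forall fun y => NNReal.zero_le_coe)]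
      simp only [ENNReal.ofReal_coe_nnreal]
    rw [heq] at hlim
    filter_upwards [hlim.eventually_lt_const (hR.trans_lt hδε)] with k hk
    rw [Function.comp_apply, div_eq_inv_mul] at hk
    refine le_trans ?_ hk.le
    rw [lintegral_empiricalMeasure (f := fun y => Ψ.scaled c y - (R : ℝ≥0)),
      ← ENNReal.ofReal_coe_nnreal]
    refine ENNReal.ofReal_le_ofReal ?_
    push_cast
    gcongr with i
    exact Ψ.scaled_mono (by gcongr)

/-- All coordinates are identically distributed, so averaging cancels `n`: the source of uniformity
in the sample size. -/
theorem lintegral_meanGap_sample (ν μ : ProbabilityMeasure ℝ) (c : ℝ≥0) (n : ℕ+) :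
    ∫⁻ u, meanGap Ψ c n (sample ν u) (sample μ u) ∂unifSeq =
      ∫⁻ v, Ψ.scaled c (quantile ν v - quantile μ v) ∂unif := by
  have hm : Measurable fun v =>
      (Ψ.scaled c (quantile (ν : Measure ℝ) v - quantile (μ : Measure ℝ) v) : ℝ≥0∞) :=
    ((Ψ.measurable_scaled c).comp
      ((measurable_quantile _).sub (measurable_quantile _))).coe_nnreal_ennreal
  have hn : ((n : ℕ) : ℝ≥0) ≠ 0 := by simp
  simp only [meanGap, ENNReal.coe_mul, ENNReal.ofNNReal_finsetSum, ENNReal.coe_inv hn,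
    ENNReal.coe_natCast, sample]
  rw [lintegral_const_mul' _ _ (by simp), lintegral_finsetSum _ fun i _ =>
    show Measurable fun u : ℕ → ℝ => (Ψ.scaled c (quantile (ν : Measure ℝ) (u i) -
      quantile (μ : Measure ℝ) (u i)) : ℝ≥0∞) from hm.comp (measurable_pi_apply i)]
  simp only [fun i => lintegral_unifSeq_eval i hm, Finset.sum_const, Finset.card_range,
    nsmul_eq_mul]
  rw [← mul_assoc, ENNReal.inv_mul_cancel (by simp) (ENNReal.natCast_ne_top _), one_mul]

theorem measurable_meanGap_sample (ν μ : ProbabilityMeasure ℝ) (c : ℝ≥0) (n : ℕ+) :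
    Measurable fun u => meanGap Ψ c n (sample ν u) (sample μ u) :=
  measurable_const.mul (Finset.measurable_sum _ fun i _ => (Ψ.measurable_scaled c).comp
    (((measurable_pi_apply i).comp (measurable_sample ν)).sub
      ((measurable_pi_apply i).comp (measurable_sample μ))))

theorem meanGap_mono {c c' : ℝ≥0} (h : c ≤ c') (n : ℕ+) (x y : ℕ → ℝ) :
    meanGap Ψ c n x y ≤ meanGap Ψ c' n x y := by
  unfold meanGap
  gcongr with i
  exact Ψ.scaled_mono (by gcongr)

/-- Along a subsequence the mean gaps of coupled samples vanish almost surely. -/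
theorem exists_subseq_meanGap_sample {ν : ℕ → ProbabilityMeasure ℝ} {μ : ProbabilityMeasure ℝ}
    (hD : ∀ c : ℝ≥0, Tendsto (fun k => ∫⁻ v, Ψ.scaled c (quantile (ν k) v - quantile μ v) ∂unif)
      atTop (𝓝 0)) (n : ℕ → ℕ+) :
    ∃ φ : ℕ → ℕ, StrictMono φ ∧ ∀ᵐ u ∂unifSeq, ∀ c : ℝ≥0,
      Tendsto (fun j => meanGap Ψ c (n (φ j)) (sample (ν (φ j)) u) (sample μ u)) atTop (𝓝 0) := by
  -- The scale `j` grows along the subsequence, so that a single null set serves all `c`.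
  obtain ⟨φ, hφ, hle⟩ := extraction_forall_of_eventually (P := fun j k =>
      ∫⁻ v, Ψ.scaled j (quantile (ν k) v - quantile μ v) ∂unif ≤ 2⁻¹ ^ j)
    (fun j => (ENNReal.tendsto_nhds_zero.1 (hD j)) (2⁻¹ ^ j) (ENNReal.pow_pos (by simp) j))
  refine ⟨φ, hφ, ?_⟩
  have hm : ∀ j : ℕ, Measurable fun u =>
      (meanGap Ψ j (n (φ j)) (sample (ν (φ j)) u) (sample μ u) : ℝ≥0∞) := fun j =>
    (measurable_meanGap_sample _ _ _ _).coe_nnreal_ennreal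
  have hsum : ∫⁻ u, ∑' j : ℕ,
      (meanGap Ψ j (n (φ j)) (sample (ν (φ j)) u) (sample μ u) : ℝ≥0∞) ∂unifSeq ≠ ∞ := by
    rw [lintegral_tsum fun j => (hm j).aemeasurable]
    simp only [lintegral_meanGap_sample]
    refine ((ENNReal.tsum_le_tsum hle).trans_lt ?_).ne
    rw [ENNReal.tsum_geometric_two]
    exact ENNReal.ofNat_lt_top
  filter_upwards [ae_lt_top' (AEMeasurable.tsum fun j => (hm j).aemeasurable) hsum] with u hu c
  have h0 := ENNReal.tendsto_atTop_zero_of_tsum_ne_top hu.ne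
  have h0' : Tendsto (fun j : ℕ => meanGap Ψ j (n (φ j)) (sample (ν (φ j)) u) (sample μ u)) atTop
      (𝓝 0) := ENNReal.tendsto_coe.1 h0
  refine tendsto_of_tendsto_of_tendsto_of_le_of_le' tendsto_const_nhds h0'
    (Eventually.of_forall fun _ => zero_le) ?_
  obtain ⟨N, hN⟩ := exists_nat_ge c
  filter_upwards [eventually_ge_atTop N] with j hj
  exact meanGap_mono (hN.trans (by exact_mod_cast hj)) _ _ _

theorem exists_subseq_const_or_tendsto (n : ℕ → ℕ+) :
    ∃ φ : ℕ → ℕ, StrictMono φ ∧ ((∃ m, ∀ k, n (φ k) = m) ∨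
      Tendsto (fun k => (n (φ k) : ℕ)) atTop atTop) := by
  by_cases h : ∃ m, ∃ᶠ k in atTop, n k = m
  · obtain ⟨m, hm⟩ := h
    obtain ⟨φ, hφ, hφm⟩ := extraction_of_frequently_atTop hm
    exact ⟨φ, hφ, Or.inl ⟨m, hφm⟩⟩
  · push Not at h
    refine ⟨id, strictMono_id, Or.inr (tendsto_atTop.2 fun b => ?_)⟩
    have hne : ∀ m ∈ Finset.range b, ∀ᶠ k in atTop, (n k : ℕ) ≠ m := by
      intro m _
      rcases Nat.eq_zero_or_pos m with rfl | hm
      · exact Eventually.of_forall fun k => (n k).ne_zero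
      · exact (h ⟨m, hm⟩).mono fun k hk hkm => hk (PNat.eq hkm)
    filter_upwards [(Filter.eventually_all_finset _).2 hne] with k hk
    by_contra hlt
    exact hk _ (Finset.mem_range.2 (not_le.1 hlt)) rfl

variable {Ω : Type*} [MeasurableSpace Ω] {P : Measure Ω}

/-- Sequential form of qualitative robustness. -/
theorem exists_levyProkhorovDist_estimatorLaw_le [IsProbabilityMeasure P] (hP : IsAtomless P)
    (ρ : RiskMeasure Ψ P) (hE : empiricalMeasures ℝ ⊆ laws Ψ P)
    {ν : ℕ → ProbabilityMeasure ℝ} {μ : ProbabilityMeasure ℝ} (hμ : HasFiniteMoments Ψ μ)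
    (hW : RampTendsto ν μ) (hT : UniformTails Ψ ν) (n : ℕ → ℕ+) {ε : ℝ} (hε : 0 < ε) :
    ∃ k, levyProkhorovDist (estimatorLaw μ (plugIn hE (riskFunctional ρ) (n k)))
      (estimatorLaw (ν k) (plugIn hE (riskFunctional ρ) (n k))) ≤ ε := by
  obtain ⟨φ, hφ, hn⟩ := exists_subseq_const_or_tendsto n
  obtain ⟨θ, hθ, hgap⟩ := exists_subseq_meanGap_sample (ν := ν ∘ φ) (μ := μ)
    (fun c => (hT.tendsto_lintegral_quantile hW hμ c).comp hφ.tendsto_atTop) (n ∘ φ)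
  let N : ℕ → ℕ+ := fun j => n (φ (θ j))
  let t : ℕ → (ℕ → ℝ) → ℝ := fun j => plugIn hE (riskFunctional ρ) (N j)
  have ht : ∀ j, Measurable (t j) := fun j => measurable_plugIn hP ρ hE _
  have hae : ∀ᵐ u ∂unifSeq, Tendsto (fun j => t j (sample (ν (φ (θ j))) u) - t j (sample μ u))
      atTop (𝓝 0) := by
    -- For a constant sample size the reference law is the fixed empirical measure of the
    -- `μ`-sample; for divergent sizes it is `μ` itself.
    rcases hn with ⟨m, hm⟩ | hn
    · filter_upwards [hgap] with u hu
      refine tendsto_plugIn_sub hP ρ hE (n := N)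
        (κ := ⟨empiricalMeasure m (sample μ u), hE ⟨m, _, rfl⟩⟩) (y := fun _ => sample μ u)
        ?_ ?_ hu
      · simpa only [N, hm] using RampTendsto.const _
      · simpa only [N, hm] using UniformTails.const (hasFiniteMoments_empiricalMeasure _ _)
    · filter_upwards [hgap, ae_empiricalMeasure_sample hμ (hn.comp hθ.tendsto_atTop)]
        with u hu1 hu2
      exact tendsto_plugIn_sub hP ρ hE (n := N) (κ := ⟨μ, (mem_laws_iff hP).2 hμ⟩)
        (y := fun _ => sample μ u) hu2.1 hu2.2 hu1
  have hmt : ∀ (j : ℕ) (κ : ProbabilityMeasure ℝ), Measurable fun u => t j (sample κ u) :=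
    fun j κ => (ht j).comp (measurable_sample κ)
  have hmeas := tendstoInMeasure_of_tendsto_ae (g := fun _ => (0 : ℝ))
    (fun j => ((hmt j (ν (φ (θ j)))).sub (hmt j μ)).aestronglyMeasurable) hae
  have hε' : 0 < ENNReal.ofReal ε := ENNReal.ofReal_pos.2 hε
  obtain ⟨j, hj⟩ := ((ENNReal.tendsto_nhds_zero.1 (hmeas _ hε')) _ hε').exists
  refine ⟨φ (θ j), ?_⟩
  rw [estimatorLaw_eq_map_sample μ (ht j), estimatorLaw_eq_map_sample (ν (φ (θ j))) (ht j)]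
  refine levyProkhorovDist_map_le (hmt j μ) (hmt j _) hε.le ?_
  refine le_trans (le_of_eq ?_) hj
  congr 1
  ext u
  rw [Set.mem_ofPred_eq, Set.mem_ofPred_eq, edist_comm, edist_dist, edist_dist, dist_zero_right,
    dist_eq_norm]
  rfl

end Coupling

end AggRobust

end


open AggRobust in
theorem mainTheorem5 {Ω : Type*} [MeasurableSpace Ω] (P : Measure Ω) [IsProbabilityMeasure P]
    (hP : IsAtomless P) (Ψ : YoungFunction) (ρ : RiskMeasure Ψ P)
    (d : ℕ) (A : (Fin d → ℝ) → ℝ) (hA : Measurable A)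
    (hgrowth : ∃ b c : ℝ, 0 < b ∧ 0 < c ∧ ∀ x : Fin d → ℝ, |A x| ≤ b + c * ∑ i, |x i|)
    (μ : Fin d → ProbabilityMeasure ℝ) (hμ : ∀ i, μ i ∈ laws Ψ P) :
    -- the image set lies in the domain of the risk functional, which is weakly continuous on it
    (∃ hM : frechetImage μ A ⊆ laws Ψ P,
      Continuous fun ν : frechetImage μ A => riskFunctional ρ (Set.inclusion hM ν)) ∧
    -- the plug-in estimators are well defined, measurable, and robust on the image set
    (∃ hE : empiricalMeasures ℝ ⊆ laws Ψ P,
      (∀ n : ℕ+, Measurable (plugIn hE (riskFunctional ρ) n)) ∧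
      IsRobustOn (plugIn hE (riskFunctional ρ)) (frechetImage μ A)) := by
  have hμ' : ∀ i, HasFiniteMoments Ψ (μ i) := fun i => hasFiniteMoments_of_mem_laws (hμ i)
  have htail := fun (c : ℝ≥0) (ε : ℝ≥0∞) (hε : 0 < ε) =>
    exists_lintegral_tsub_le_frechetImage hA hgrowth hμ' c hε
  have hfin : ∀ ν ∈ frechetImage μ A, HasFiniteMoments Ψ ν := fun ν hν =>
    hasFiniteMoments_of_lintegral_tsub fun c => by
      obtain ⟨R, hR⟩ := htail c 1 zero_lt_one
      exact ⟨R, (hR ν hν).trans_lt ENNReal.one_lt_top⟩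
  have hunif : ∀ ν : ℕ → frechetImage μ A, UniformTails Ψ fun k => ν k := fun ν c ε hε => by
    obtain ⟨R, hR⟩ := htail c ε hε
    exact ⟨R, Eventually.of_forall fun k => hR _ (ν k).2⟩
  have hramp : ∀ (ν : ℕ → frechetImage μ A) (κ : frechetImage μ A), Tendsto ν atTop (𝓝 κ) →
      RampTendsto (fun k => ν k) κ := fun ν κ h =>
    rampTendsto_of_tendsto ((continuous_subtype_val.tendsto κ).comp h)
  refine ⟨⟨fun ν hν => (mem_laws_iff hP).2 (hfin ν hν), ?_⟩,
    empiricalMeasures_subset_laws hP, measurable_plugIn hP ρ _, fun κ ε hε => ?_⟩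
  · refine continuous_iff_seqContinuous.2 fun ν κ h => ?_
    exact tendsto_riskFunctional hP ρ (hramp ν κ h) (hunif ν)
  · set hE := empiricalMeasures_subset_laws (Ψ := Ψ) hP
    let good : Set (frechetImage μ A) := {ν | ∀ n : ℕ+,
      levyProkhorovDist (estimatorLaw (κ : ProbabilityMeasure ℝ) (plugIn hE (riskFunctional ρ) n))
        (estimatorLaw (ν : ProbabilityMeasure ℝ) (plugIn hE (riskFunctional ρ) n)) ≤ ε}
    suffices hgood : good ∈ 𝓝 κ by
      obtain ⟨U, hU, hUo, hκU⟩ := mem_nhds_iff.1 hgood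
      exact ⟨U, hUo, hκU, fun ν hν => hU hν⟩
    -- The neighbourhood filter is countably generated, so a failure yields a sequence of bad laws
    -- converging to `κ`, each with its own sample size.
    by_contra hbad
    obtain ⟨ν, hν, hνbad⟩ := exists_seq_forall_of_frequently
      (l := 𝓝 κ) (p := fun ν => ν ∉ good) fun h => hbad (h.mono fun _ => not_not.1)
    have hex : ∀ k, ∃ n : ℕ+, ε < levyProkhorovDist
        (estimatorLaw (κ : ProbabilityMeasure ℝ) (plugIn hE (riskFunctional ρ) n))
        (estimatorLaw (ν k : ProbabilityMeasure ℝ) (plugIn hE (riskFunctional ρ) n)) := fun k => by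
      by_contra hcon
      push Not at hcon
      exact hνbad k hcon
    choose n hn using hex
    obtain ⟨k, hk⟩ := exists_levyProkhorovDist_estimatorLaw_le hP ρ hE (hfin κ κ.2)
      (hramp ν κ hν) (hunif ν) n hε
    exact hk.not_gt (hn k)
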